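/- **Hidden steering of the doubly flagged Werner state.** Conventions. For a state $\rho$ on $\mathbb{C}^m\otimes\mathbb{C}^n$ (first factor Alice, second Bob) and POVMs $\{M_{a|x}\}_a$ of Alice (finitely many outcomes, arbitrary set of settings $x$), the assemblage is $\sigma_{a|x}=\mathrm{tr}_A[(M_{a|x}\otimes\mathbb{I})\rho]$. It has a local-hidden-state (LHS) decomposition if $\sigma_{a|x}=\int d\mu(\lambda)\,p(a|x,\lambda)\,\sigma_\lambda$ for a probability measure $\mu$, response functions $p(\cdot|x,\lambda)$ and quantum states $\sigma_\lambda$. The state $\rho$ has an LHS model for POVMs from Alice to Bob if every assemblage obtained from POVMs has such a decomposition (the family of all POVMs at once included); otherwise $\rho$ is steerable from Alice to Bob. From Bob to Alice is defined by exchanging the parties. Let $d\ge 2$, and let $$\tilde\rho_W=\alpha\,\frac{2P^{anti}}{d(d-1)}+(1-\alpha)\frac{\mathbb{I}_{d^2}}{d^2},\qquad \alpha=\frac{d-1}{d},$$ be the Werner state on $\mathbb{C}^d\otimes\mathbb{C}^d$, where $P^{anti}$ is the projector on the antisymmetric subspace. For a state $\rho$ whose first party has dimension $d$, with reduced state $\rho_B=\mathrm{tr}_A\rho$,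 the flag extension on Alice's side is $\frac{1}{d+1}[\rho+d\,P_\perp\otimes\rho_B]$, where $P_\perp=|d\rangle\langle d|$ projects on one additional dimension of Alice's system $\mathbb{C}^{d+1}=\mathbb{C}^d\oplus\mathbb{C}|d\rangle$; the extension on Bob's side is defined in the same way. Let $\rho_{HS}$, on $\mathbb{C}^{d+1}\otimes\mathbb{C}^{d+1}$, be obtained from $\tilde\rho_W$ by the flag extension first on Alice's side and then on Bob's side. Then: 1. $\rho_{HS}$ is a quantum state, and, with $\mathbb{I}_d$ the projector on $\mathbb{C}^d\subset\mathbb{C}^{d+1}$, $$\rho_{HS}=\frac{1}{(d+1)^2}\Big[\tilde\rho_W+d\Big(P_\perp\otimes\frac{\mathbb{I}_d}{d}+\frac{\mathbb{I}_d}{d}\otimes P_\perp\Big)+d^2P_\perp\otimes P_\perp\Big].$$ 2. $\rho_{HS}$ has LHS models for POVMs from Alice to Bob and from Bob to Alice. 3. With the local filters $F_A=F_B=|0\rangle\langle0|+|1\rangle\langle1|$ one has $\mathrm{tr}[(F_A\otimes F_B)\rho_{HS}(F_A^\dagger\otimes F_B^\dagger)]\neq0$ and $$\frac{(F_A\otimes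 F_B)\rho_{HS}(F_A^\dagger\otimes F_B^\dagger)}{\mathrm{tr}[(F_A\otimes F_B)\rho_{HS}(F_A^\dagger\otimes F_B^\dagger)]}=\frac{1}{1+\frac2d}\Big[|\psi^-\rangle\langle\psi^-|+\frac2d\,\frac{\mathbb{I}_4}{4}\Big],\qquad |\psi^-\rangle=\frac{|01\rangle-|10\rangle}{\sqrt2},$$ the two-qubit Werner state with visibility $1/(1+2/d)$ on the span of $|0\rangle,|1\rangle$ on each side. 4. If $d\ge3$, this filtered state is steerable (using POVMs) both from Alice to Bob and from Bob to Alice, whether regarded as a two-qubit state or as a state on $\mathbb{C}^{d+1}\otimes\mathbb{C}^{d+1}$. Hence $\rho_{HS}$ has hidden steering: it has LHS models for POVMs in both directions, but there are first-round local measurements, given by Kraus operators, and a pair of outcomes of non-zero probability after which the post-measurement state is steerable. -/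

import Mathlib

open scoped Kronecker Matrix ComplexOrder
open MeasureTheory

noncomputable section

namespace Steering

/-! Finite-dimensional Hilbert spaces are `ℂ^m` for a finite index type `m`. An operator on
`ℂ^m ⊗ ℂ^n` is a matrix indexed by `m × n`; the first factor is Alice's, the second Bob's. -/

/-- Density matrices (quantum states). -/
def IsDensity {n : Type*} [Fintype n] (ρ : Matrix n n ℂ) : Prop :=
  ρ.PosSemidef ∧ ρ.trace = 1

/-- Partial trace over Alice's system. -/
def ptraceA {m n : Type*} [Fintype m] (ρ : Matrix (m × n) (m × n) ℂ) : Matrix n n ℂ :=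
  Matrix.of fun i j => ∑ k, ρ (k, i) (k, j)

/-- The same operator with the roles of Alice and Bob exchanged. -/
def exchange {m n : Type*} (ρ : Matrix (m × n) (m × n) ℂ) : Matrix (n × m) (n × m) ℂ :=
  ρ.submatrix Prod.swap Prod.swap

/-- A POVM on `ℂ^m` with `k` outcomes. -/
structure POVM (k : ℕ) (m : Type*) [Fintype m] [DecidableEq m] where
  elem : Fin k → Matrix m m ℂ
  posSemidef : ∀ a, (elem a).PosSemidef
  sum_eq_one : ∑ a, elem a = 1

/-- The assemblage `σ_{a|x} = tr_A((M_{a|x} ⊗ 𝟙) ρ)` that Alice prepares on Bob's side by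
performing on `ρ` the measurements `M x`, where `x` ranges over an arbitrary set of settings. -/
def assemblage {m n : Type*} [Fintype m] [DecidableEq m] [Fintype n] [DecidableEq n]
    (ρ : Matrix (m × n) (m × n) ℂ) {X : Type} {k : X → ℕ} (M : ∀ x, POVM (k x) m)
    (x : X) (a : Fin (k x)) : Matrix n n ℂ :=
  ptraceA (((M x).elem a ⊗ₖ (1 : Matrix n n ℂ)) * ρ)

/-- `σ_{a|x} = ∫ dμ(λ) p(a|x,λ) σ_λ` for a hidden variable `λ` distributed according to a
probability measure `μ`, local response functions `p(·|x,λ)` and quantum states `σ_λ`. -/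
def HasLHSDecomposition {n : Type*} [Fintype n] {X : Type} {k : X → ℕ}
    (σ : ∀ x, Fin (k x) → Matrix n n ℂ) : Prop :=
  ∃ (Λ : Type) (_ : MeasurableSpace Λ) (μ : Measure Λ) (p : ∀ x, Fin (k x) → Λ → ℝ)
    (τ : Λ → Matrix n n ℂ),
    IsProbabilityMeasure μ ∧
    (∀ x a, Measurable (p x a)) ∧
    (∀ x a l, 0 ≤ p x a l) ∧
    (∀ x l, ∑ a, p x a l = 1) ∧
    (∀ i j, Measurable fun l => τ l i j) ∧
    (∀ l, IsDensity (τ l)) ∧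
    ∀ x a i j, σ x a i j = ∫ l, (p x a l : ℂ) * τ l i j ∂μ

/-- `ρ` is unsteerable from Alice to Bob, i.e. admits an LHS model for POVMs. The family `M` may
consist of all POVMs at once, so that a single hidden variable serves for all of them. -/
def UnsteerableAB {m n : Type*} [Fintype m] [DecidableEq m] [Fintype n] [DecidableEq n]
    (ρ : Matrix (m × n) (m × n) ℂ) : Prop :=
  ∀ (X : Type) (k : X → ℕ) (M : ∀ x, POVM (k x) m), HasLHSDecomposition (assemblage ρ M)

/-- `ρ` is unsteerable from Bob to Alice. -/
def UnsteerableBA {m n : Type*} [Fintype m] [DecidableEq m] [Fintype n] [DecidableEq n]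
    (ρ : Matrix (m × n) (m × n) ℂ) : Prop :=
  UnsteerableAB (exchange ρ)

/-- Alice can steer Bob: for some set of POVMs the assemblage has no LHS decomposition. -/
def SteerableAB {m n : Type*} [Fintype m] [DecidableEq m] [Fintype n] [DecidableEq n]
    (ρ : Matrix (m × n) (m × n) ℂ) : Prop :=
  ∃ (X : Type) (k : X → ℕ) (M : ∀ x, POVM (k x) m), ¬ HasLHSDecomposition (assemblage ρ M)

/-- Bob can steer Alice. -/
def SteerableBA {m n : Type*} [Fintype m] [DecidableEq m] [Fintype n] [DecidableEq n]
    (ρ : Matrix (m × n) (m × n) ℂ) : Prop :=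
  SteerableAB (exchange ρ)

/-- The unnormalised state `(F_A ⊗ F_B) ρ (F_A† ⊗ F_B†)`; its trace is the probability that both
filters succeed. -/
def filterRaw {m n : Type*} [Fintype m] [Fintype n] (FA : Matrix m m ℂ) (FB : Matrix n n ℂ)
    (ρ : Matrix (m × n) (m × n) ℂ) : Matrix (m × n) (m × n) ℂ :=
  (FA ⊗ₖ FB) * ρ * (FAᴴ ⊗ₖ FBᴴ)

/-- The normalised state after successful local filtering on both sides. -/
def filtered {m n : Type*} [Fintype m] [Fintype n] (FA : Matrix m m ℂ) (FB : Matrix n n ℂ)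
    (ρ : Matrix (m × n) (m × n) ℂ) : Matrix (m × n) (m × n) ℂ :=
  ((filterRaw FA FB ρ).trace)⁻¹ • filterRaw FA FB ρ

/-- A (non-destructive) quantum measurement with `k` outcomes, given by its Kraus operators. -/
structure LocalMeasurement (k : ℕ) (m : Type*) [Fintype m] [DecidableEq m] where
  kraus : Fin k → Matrix m m ℂ
  complete : ∑ i, (kraus i)ᴴ * kraus i = 1

/-- Hidden steering: the state admits LHS models for POVMs in both directions, but after a first
round of local measurements by Alice and Bob the post-measurement state, for some pair of outcomes
of non-zero probability, is steerable by a second round of measurements. -/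
def HasHiddenSteering {m n : Type*} [Fintype m] [DecidableEq m] [Fintype n] [DecidableEq n]
    (ρ : Matrix (m × n) (m × n) ℂ) : Prop :=
  UnsteerableAB ρ ∧ UnsteerableBA ρ ∧
    ∃ (k l : ℕ) (A : LocalMeasurement k m) (B : LocalMeasurement l n) (i : Fin k) (j : Fin l),
      (filterRaw (A.kraus i) (B.kraus j) ρ).trace ≠ 0 ∧
      (SteerableAB (filtered (A.kraus i) (B.kraus j) ρ) ∨
        SteerableBA (filtered (A.kraus i) (B.kraus j) ρ))

/-- The swap operator `|i j⟩ ↦ |j i⟩` on `ℂ^d ⊗ ℂ^d`. -/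
def swapOp (d : ℕ) : Matrix (Fin d × Fin d) (Fin d × Fin d) ℂ :=
  Matrix.of fun p q => if p = q.swap then 1 else 0

/-- The projector on the antisymmetric subspace of `ℂ^d ⊗ ℂ^d`. -/
def antiProj (d : ℕ) : Matrix (Fin d × Fin d) (Fin d × Fin d) ℂ :=
  (1 / 2 : ℝ) • (1 - swapOp d)

/-- The Werner state `α 2 P^anti / (d (d - 1)) + (1 - α) 𝟙 / d²`. -/
def werner (d : ℕ) (α : ℝ) : Matrix (Fin d × Fin d) (Fin d × Fin d) ℂ :=
  (α * (2 / ((d : ℝ) * ((d : ℝ) - 1)))) • antiProj d + ((1 - α) * (1 / (d : ℝ) ^ 2)) • 1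

/-- The inclusion of `ℂ^m` in `ℂ^m ⊕ ℂ`. -/
def incl (m : Type*) [DecidableEq m] : Matrix (m ⊕ Unit) m ℂ :=
  Matrix.fromRows 1 0

/-- The projector `P_⊥` on the additional (flag) dimension of `ℂ^m ⊕ ℂ`. -/
def flagProj (m : Type*) [DecidableEq m] : Matrix (m ⊕ Unit) (m ⊕ Unit) ℂ :=
  Matrix.single (Sum.inr ()) (Sum.inr ()) 1

/-- Flag extension on Alice's side: `(ρ + d P_⊥ ⊗ ρ_B) / (d + 1)`, with `d` the dimension of
Alice's system. -/
def flagA {m n : Type*} [Fintype m] [DecidableEq m] [Fintype n] [DecidableEq n]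
    (ρ : Matrix (m × n) (m × n) ℂ) : Matrix ((m ⊕ Unit) × n) ((m ⊕ Unit) × n) ℂ :=
  (1 / ((Fintype.card m : ℝ) + 1)) •
    ((incl m ⊗ₖ (1 : Matrix n n ℂ)) * ρ * (incl m ⊗ₖ (1 : Matrix n n ℂ))ᴴ
      + (Fintype.card m : ℝ) • (flagProj m ⊗ₖ ptraceA ρ))

/-- Flag extension on Bob's side. -/
def flagB {m n : Type*} [Fintype m] [DecidableEq m] [Fintype n] [DecidableEq n]
    (ρ : Matrix (m × n) (m × n) ℂ) : Matrix (m × (n ⊕ Unit)) (m × (n ⊕ Unit)) ℂ :=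
  exchange (flagA (exchange ρ))

/-- The doubly flagged Werner state: the flag extension, first on Alice's and then on Bob's side,
of the Werner state with `α = (d - 1) / d`. -/
def rhoHS (d : ℕ) :
    Matrix ((Fin d ⊕ Unit) × (Fin d ⊕ Unit)) ((Fin d ⊕ Unit) × (Fin d ⊕ Unit)) ℂ :=
  flagB (flagA (werner d (((d : ℝ) - 1) / d)))

/-- The inclusion of the qubit space `ℂ²` in `ℂ^d ⊕ ℂ` as the span of `|0⟩` and `|1⟩`. -/
def qubitIncl {d : ℕ} (hd : 2 ≤ d) : Matrix (Fin d ⊕ Unit) (Fin 2) ℂ :=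
  ∑ k : Fin 2, Matrix.single (Sum.inl (Fin.castLE hd k)) k 1

/-- The local filter `|0⟩⟨0| + |1⟩⟨1|` on `ℂ^d ⊕ ℂ`. -/
def qubitFilter {d : ℕ} (hd : 2 ≤ d) : Matrix (Fin d ⊕ Unit) (Fin d ⊕ Unit) ℂ :=
  ∑ k : Fin 2, Matrix.single (Sum.inl (Fin.castLE hd k)) (Sum.inl (Fin.castLE hd k)) 1

/-- The singlet vector `|ψ⁻⟩ = (|01⟩ - |10⟩) / √2`. -/
def singletVec : Fin 2 × Fin 2 → ℂ :=
  ((1 / Real.sqrt 2 : ℝ) : ℂ) • (Pi.single (0, 1) 1 - Pi.single (1, 0) 1)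

/-- The singlet state `|ψ⁻⟩⟨ψ⁻|`. -/
def singlet : Matrix (Fin 2 × Fin 2) (Fin 2 × Fin 2) ℂ :=
  Matrix.vecMulVec singletVec (star singletVec)

end Steering

end

/-! The construction turns Werner's hidden-state model for projective measurements into a model for
POVMs at the price of the flags.

Let the hidden variable be a random direction `z` in `ℂ^d`, with the pure state along `z` as Bob's
state. To a rank-one projector of an orthonormal basis assign the region where its overlap with `z`
is the smallest in that basis. A Gaussian computation shows that the average state over this region
is proportional to `(1 + 1/d) 𝟙` minus the projector, which is exactly Bob's conditional state for
the Werner state at `α = (d - 1)/d` (`integral_minIndicator_entry`, `ptraceA_mul_werner_critical`).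
By the spectral theorem every effect `N` gets a response between `0` and `tr N` (`exists_response`).
The effects of a POVM have different eigenbases, so their responses need not sum to one; their sum
is only known to be at most `d`.

The flag on Alice's side repairs this. After division by `d + 1` the responses leave a nonnegative
remainder, which is handed out according to the probabilities that the POVM assigns to the flag
vector. On average the remainder carries the weight `d/(d + 1)` of `ρ_B`, which is the flag term
(`EffectModel.unsteerableAB_flagA`). The flag on Bob's side is a local channel, applied to the
hidden states (`UnsteerableAB.flagB`). Since the doubly flagged state is symmetric, the same model
serves in the other direction (`exchange_rhoHS`).

The filters remove the flags and compress the antisymmetric projector of `ℂ^d` to the singlet, with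
the visibility raised to `1/(1 + 2/d)` (`qubit_compression_rhoHS`). A three-setting Pauli inequality
bounds unsteerable correlations by `√3`, while the Werner state reaches three times its visibility;
for `d ≥ 3` the visibility exceeds `1/√3`. -/

namespace Steering

/-! ### Gaussian integrals over `ℂ^d` -/

/-- Polar coordinates: the radial integrand is `y * f y`, whose antiderivative `G` vanishes at
infinity, and the unit disc has area `π`. -/
theorem integral_complex_norm_ge {f G : ℝ → ℝ} {r : ℝ} (hr : 0 ≤ r)
    (hG : ∀ y, HasDerivAt G (y * f y) y) (hf : ∀ y, 0 ≤ f y)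
    (hlim : Filter.Tendsto G Filter.atTop (nhds 0)) :
    ∫ z : ℂ, (if r ≤ ‖z‖ then f ‖z‖ else 0) = 2 * Real.pi * (-G r) := by
  have h := integral_fun_norm_addHaar (volume : Measure ℂ) (fun y => if r ≤ y then f y else 0)
  rw [h, Complex.finrank_real_complex]
  have h1 : (volume : Measure ℂ).real (Metric.ball 0 1) = Real.pi := by
    simp [Measure.real, Complex.volume_ball]
  have h2 : ∫ y in Set.Ioi (0 : ℝ), y ^ (2 - 1) • (if r ≤ y then f y else 0)
      = ∫ y in Set.Ioi r, y * f y := by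
    have : ∀ y : ℝ, y ^ (2 - 1) • (if r ≤ y then f y else 0)
        = (Set.Ici r).indicator (fun y => y * f y) y := by
      intro y
      by_cases hy : r ≤ y <;> simp [hy]
    simp_rw [this]
    rw [← integral_Ici_eq_integral_Ioi, setIntegral_indicator measurableSet_Ici,
      Set.Ici_inter_Ici, sup_of_le_right hr, integral_Ici_eq_integral_Ioi]
  rw [h1, h2, integral_Ioi_of_hasDerivAt_of_nonneg' (fun y _ => hG y)
    (fun y hy => mul_nonneg (hr.trans (le_of_lt hy)) (hf y)) hlim]
  simp
  ring

theorem tendsto_exp_neg_mul_sq {b : ℝ} (hb : 0 < b) :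
    Filter.Tendsto (fun y : ℝ => Real.exp (-(b * y ^ 2))) Filter.atTop (nhds 0) :=
  Real.tendsto_exp_neg_atTop_nhds_zero.comp
    ((Filter.tendsto_pow_atTop two_ne_zero).const_mul_atTop hb)

theorem tendsto_mul_exp_neg_mul_sq {b : ℝ} (hb : 0 < b) :
    Filter.Tendsto (fun y : ℝ => b * y ^ 2 * Real.exp (-(b * y ^ 2))) Filter.atTop (nhds 0) := by
  have h := (Real.tendsto_pow_mul_exp_neg_atTop_nhds_zero 1).comp
    ((Filter.tendsto_pow_atTop (α := ℝ) two_ne_zero).const_mul_atTop hb)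
  simpa [Function.comp_def] using h

theorem hasDerivAt_exp_neg_mul_sq (b y : ℝ) :
    HasDerivAt (fun y : ℝ => Real.exp (-(b * y ^ 2))) (Real.exp (-(b * y ^ 2)) * (-(b * (2 * y)))) y := by
  have h := (((hasDerivAt_pow 2 y).const_mul b).neg).exp
  simpa using h

theorem integral_exp_norm_ge {b r : ℝ} (hb : 0 < b) (hr : 0 ≤ r) :
    ∫ z : ℂ, (if r ≤ ‖z‖ then Real.exp (-(b * ‖z‖ ^ 2)) else 0)
      = Real.pi * (Real.exp (-(b * r ^ 2)) / b) := by
  rw [integral_complex_norm_ge (f := fun y => Real.exp (-(b * y ^ 2)))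
    (G := fun y => Real.exp (-(b * y ^ 2)) * (-1 / (2 * b))) hr]
  · field_simp
  · intro y
    exact ((hasDerivAt_exp_neg_mul_sq b y).mul_const (-1 / (2 * b))).congr_deriv (by field_simp)
  · intro y; positivity
  · simpa using (tendsto_exp_neg_mul_sq hb).mul_const (-1 / (2 * b))

theorem integral_sq_exp_norm_ge {b r : ℝ} (hb : 0 < b) (hr : 0 ≤ r) :
    ∫ z : ℂ, (if r ≤ ‖z‖ then ‖z‖ ^ 2 * Real.exp (-(b * ‖z‖ ^ 2)) else 0)
      = Real.pi * ((1 / b ^ 2 + r ^ 2 / b) * Real.exp (-(b * r ^ 2))) := by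
  rw [integral_complex_norm_ge (f := fun y => y ^ 2 * Real.exp (-(b * y ^ 2)))
    (G := fun y => (1 + b * y ^ 2) * Real.exp (-(b * y ^ 2)) * (-1 / (2 * b ^ 2))) hr]
  · field_simp
  · intro y
    have h := (((hasDerivAt_pow 2 y).const_mul b).const_add 1).mul (hasDerivAt_exp_neg_mul_sq b y)
    refine (h.mul_const (-1 / (2 * b ^ 2))).congr_deriv ?_
    field_simp
    simp
    ring
  · intro y; positivity
  · have h := ((tendsto_exp_neg_mul_sq hb).add (tendsto_mul_exp_neg_mul_sq hb)).mul_const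
      (-1 / (2 * b ^ 2))
    simpa [add_mul] using h

/-- The Bochner integral of a non-integrable function is `0` by convention, so a nonzero value of
the integral proves integrability. The same device recurs below. -/
theorem integrable_exp_neg_norm_sq_complex {b : ℝ} (hb : 0 < b) :
    Integrable (fun z : ℂ => Real.exp (-(b * ‖z‖ ^ 2))) := by
  have h := integral_exp_norm_ge hb le_rfl
  simp only [norm_nonneg, if_true] at h
  by_contra hn
  rw [integral_undef hn] at h
  have : 0 < Real.pi * (Real.exp (-(b * 0 ^ 2)) / b) := by positivity
  linarith

/-- The Gaussian weight on `ℂ^d`. -/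
noncomputable def gaussWeight {ι : Type*} [Fintype ι] (z : ι → ℂ) : ℝ :=
  Real.exp (-∑ k, ‖z k‖ ^ 2)

theorem gaussWeight_eq_prod {ι : Type*} [Fintype ι] (z : ι → ℂ) :
    gaussWeight z = ∏ k, Real.exp (-‖z k‖ ^ 2) := by
  rw [gaussWeight, ← Finset.sum_neg_distrib, Real.exp_sum]

theorem measurable_gaussWeight {ι : Type*} [Fintype ι] :
    Measurable (gaussWeight : (ι → ℂ) → ℝ) := by
  unfold gaussWeight
  fun_prop

theorem integrable_mul_gaussWeight {ι : Type*} [Fintype ι] {h : (ι → ℂ) → ℂ} (hm : Measurable h)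
    (hb : ∀ z, ‖h z‖ ≤ ∑ k, ‖z k‖ ^ 2) :
    Integrable (fun z => h z * (gaussWeight z : ℂ)) := by
  have h1 : Integrable (fun z : ι → ℂ => ∏ k, Real.exp (-((1 / 2) * ‖z k‖ ^ 2))) :=
    Integrable.fintype_prod (μ := fun _ => (volume : Measure ℂ))
      (f := fun _ z => Real.exp (-((1 / 2) * ‖z‖ ^ 2)))
      fun _ => integrable_exp_neg_norm_sq_complex (by norm_num)
  refine (h1.const_mul 2).mono'
    (hm.mul (Complex.measurable_ofReal.comp measurable_gaussWeight)).aestronglyMeasurable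
    (Filter.Eventually.of_forall fun z => ?_)
  rw [norm_mul, Complex.norm_real, Real.norm_eq_abs, gaussWeight, abs_of_pos (Real.exp_pos _),
    ← Real.exp_sum, Finset.sum_neg_distrib, ← Finset.mul_sum]
  set s := ∑ k, ‖z k‖ ^ 2
  -- Half of the Gaussian exponent absorbs the quadratic growth; the other half is the integrable
  -- majorant.
  have h2 : s ≤ 2 * Real.exp (s / 2) := by
    have := Real.add_one_le_exp (s / 2)
    linarith
  calc ‖h z‖ * Real.exp (-s) ≤ 2 * Real.exp (s / 2) * Real.exp (-s) := by
        gcongr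
        exact (hb z).trans h2
    _ = 2 * Real.exp (-(1 / 2 * s)) := by
        rw [mul_assoc, ← Real.exp_add]
        ring_nf

/-- The indicator function of the set where the `i`-th coordinate has minimal modulus. -/
noncomputable def minIndicator {ι : Type*} (i : ι) (z : ι → ℂ) : ℝ :=
  open Classical in if ∀ j, ‖z i‖ ≤ ‖z j‖ then 1 else 0

theorem minIndicator_nonneg {ι : Type*} (i : ι) (z : ι → ℂ) : 0 ≤ minIndicator i z := by
  unfold minIndicator
  split_ifs <;> simp

theorem minIndicator_le_one {ι : Type*} (i : ι) (z : ι → ℂ) : minIndicator i z ≤ 1 := by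
  unfold minIndicator
  split_ifs <;> simp

theorem measurable_minIndicator {ι : Type*} [Fintype ι] (i : ι) :
    Measurable (minIndicator i : (ι → ℂ) → ℝ) := by
  unfold minIndicator
  refine Measurable.ite ?_ measurable_const measurable_const
  rw [Set.ofPred_forall]
  exact MeasurableSet.iInter fun j => measurableSet_le (by fun_prop) (by fun_prop)

theorem norm_sq_le_sum {ι : Type*} [Fintype ι] (z : ι → ℂ) (k : ι) : ‖z k‖ ^ 2 ≤ ∑ j, ‖z j‖ ^ 2 :=
  Finset.single_le_sum (f := fun j => ‖z j‖ ^ 2) (fun _ _ => by positivity) (Finset.mem_univ k)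

theorem norm_mul_norm_le_sum {ι : Type*} [Fintype ι] (z : ι → ℂ) (k l : ι) :
    ‖z k‖ * ‖z l‖ ≤ ∑ j, ‖z j‖ ^ 2 := by
  have h1 := norm_sq_le_sum z k
  have h2 := norm_sq_le_sum z l
  nlinarith [sq_nonneg (‖z k‖ - ‖z l‖)]

theorem integrable_entry {ι : Type*} [Fintype ι] {f : (ι → ℂ) → ℝ} (hf : Measurable f)
    (h0 : ∀ z, 0 ≤ f z) (h1 : ∀ z, f z ≤ 1) (k l : ι) :
    Integrable (fun z : ι → ℂ => (f z : ℂ) * (z k * star (z l)) * (gaussWeight z : ℂ)) := by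
  refine integrable_mul_gaussWeight (h := fun z => (f z : ℂ) * (z k * star (z l))) ?_ fun z => ?_
  · refine (Complex.measurable_ofReal.comp hf).mul ?_
    exact (measurable_pi_apply k).mul (continuous_star.measurable.comp (measurable_pi_apply l))
  · rw [norm_mul, norm_mul, norm_star, Complex.norm_real, Real.norm_eq_abs, abs_of_nonneg (h0 z)]
    calc f z * (‖z k‖ * ‖z l‖) ≤ 1 * (‖z k‖ * ‖z l‖) := by gcongr; exact h1 z
      _ ≤ _ := by rw [one_mul]; exact norm_mul_norm_le_sum z k l

theorem integral_norm_sq_gaussWeight {ι : Type*} [Fintype ι] [DecidableEq ι] (k : ι) :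
    ∫ z : ι → ℂ, ‖z k‖ ^ 2 * gaussWeight z = Real.pi ^ Fintype.card ι := by
  have h : ∀ z : ι → ℂ, ‖z k‖ ^ 2 * gaussWeight z
      = ∏ j, ((if j = k then ‖z j‖ ^ 2 else 1) * Real.exp (-‖z j‖ ^ 2)) := by
    intro z
    rw [gaussWeight_eq_prod, Finset.prod_mul_distrib]
    simp
  simp_rw [h]
  rw [integral_fintype_prod_volume_eq_prod (𝕜 := ℝ) (E := fun _ : ι => ℂ)
    (fun j z => (if j = k then ‖z‖ ^ 2 else 1) * Real.exp (-‖z‖ ^ 2))]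
  have h2 : ∀ j, ∫ z : ℂ, (if j = k then ‖z‖ ^ 2 else 1) * Real.exp (-‖z‖ ^ 2) = Real.pi := by
    intro j
    split_ifs
    · simpa using integral_sq_exp_norm_ge one_pos le_rfl
    · simpa using integral_exp_norm_ge one_pos le_rfl
  rw [Finset.prod_congr rfl fun j _ => h2 j]
  simp

/-- Split off the coordinate `x = z i`. For fixed `x` the minimality condition says `‖x‖ ≤ ‖z j‖`
for each other `j` separately, so the inner integral is a product of `n` Gaussian tails. Each gives
`π * exp (-‖x‖ ^ 2)`, with an extra factor `1 + ‖x‖ ^ 2` at `j = k`. What remains is one Gaussian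
integral of rate `n + 1`. -/
theorem integral_minIndicator_norm_sq (n : ℕ) (i k : Fin (n + 1)) :
    ∫ z : Fin (n + 1) → ℂ, minIndicator i z * ‖z k‖ ^ 2 * gaussWeight z
      = Real.pi ^ (n + 1) *
        (if k = i then 1 / ((n : ℝ) + 1) ^ 2 else 1 / ((n : ℝ) + 1) + 1 / ((n : ℝ) + 1) ^ 2) := by
  set F : (Fin (n + 1) → ℂ) → ℝ := fun z => minIndicator i z * ‖z k‖ ^ 2 * gaussWeight z with hF
  have hint : Integrable F := by
    have := (integrable_entry (measurable_minIndicator i) (minIndicator_nonneg i)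
      (minIndicator_le_one i) k k).norm
    refine this.congr (Filter.Eventually.of_forall fun z => ?_)
    simp only [hF, norm_mul, norm_star, Complex.norm_real, Real.norm_eq_abs,
      abs_of_nonneg (minIndicator_nonneg i z), gaussWeight, abs_of_pos (Real.exp_pos _)]
    ring
  have hmp := (volume_preserving_piFinSuccAbove (fun _ : Fin (n + 1) => ℂ) i).symm
  let c : ℂ → ℝ := fun x => (if i = k then ‖x‖ ^ 2 else 1) * Real.exp (-‖x‖ ^ 2)
  let h : ℂ → Fin n → ℂ → ℝ := fun x j y => if ‖x‖ ≤ ‖y‖ then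
    (if i.succAbove j = k then ‖y‖ ^ 2 else 1) * Real.exp (-‖y‖ ^ 2) else 0
  have hfac : ∀ p : ℂ × (Fin n → ℂ),
      F ((MeasurableEquiv.piFinSuccAbove (fun _ : Fin (n + 1) => ℂ) i).symm p)
        = c p.1 * ∏ j, h p.1 j (p.2 j) := by
    rintro ⟨x, y⟩
    have e : (MeasurableEquiv.piFinSuccAbove (fun _ : Fin (n + 1) => ℂ) i).symm (x, y)
      = i.insertNth x y := rfl
    rw [e, hF]
    simp only [gaussWeight_eq_prod, Fin.prod_univ_succAbove _ i, Fin.insertNth_apply_same,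
      Fin.insertNth_apply_succAbove, c]
    by_cases hall : ∀ j, ‖x‖ ≤ ‖y j‖
    · have h1 : minIndicator i (i.insertNth x y : Fin (n + 1) → ℂ) = 1 := by
        rw [minIndicator, if_pos]
        intro j
        induction j using Fin.succAboveCases i <;> simp [hall]
      have h2 : ∀ j, h x j (y j)
          = (if i.succAbove j = k then ‖y j‖ ^ 2 else 1) * Real.exp (-‖y j‖ ^ 2) := by
        intro j
        simp [h, hall j]
      rw [h1]
      simp_rw [h2]
      rw [Finset.prod_mul_distrib]
      induction k using Fin.succAboveCases i with
      | x => simp [Fin.succAbove_ne, mul_assoc]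
      | p k =>
        simp [(Fin.succAbove_ne _ _).symm]
        ring
    · have h1 : minIndicator i (i.insertNth x y : Fin (n + 1) → ℂ) = 0 := by
        rw [minIndicator, if_neg]
        push Not at hall ⊢
        obtain ⟨j, hj⟩ := hall
        exact ⟨i.succAbove j, by simpa using hj⟩
      push Not at hall
      obtain ⟨j, hj⟩ := hall
      have h0 : ∏ j, h x j (y j) = 0 :=
        Finset.prod_eq_zero (Finset.mem_univ j) (if_neg hj.not_ge)
      rw [h1, h0]
      simp
  have hint2 : Integrable (fun p : ℂ × (Fin n → ℂ) => c p.1 * ∏ j, h p.1 j (p.2 j))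
      (volume.prod volume) := by
    have := hmp.integrable_comp_of_integrable hint
    exact this.congr (Filter.Eventually.of_forall hfac)
  have hinner : ∀ x : ℂ, ∫ y : Fin n → ℂ, c x * ∏ j, h x j (y j)
      = Real.pi ^ n * ((if k = i then ‖x‖ ^ 2 else 1 + ‖x‖ ^ 2)
          * Real.exp (-(((n : ℝ) + 1) * ‖x‖ ^ 2))) := by
    intro x
    rw [integral_const_mul, integral_fintype_prod_volume_eq_prod (𝕜 := ℝ) (E := fun _ : Fin n => ℂ)
      (fun j y => h x j y)]
    have h2 : ∀ j, ∫ y : ℂ, h x j y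
        = (if i.succAbove j = k then 1 + ‖x‖ ^ 2 else 1) * (Real.pi * Real.exp (-‖x‖ ^ 2)) := by
      intro j
      simp only [h]
      split_ifs
      · have := integral_sq_exp_norm_ge one_pos (norm_nonneg x)
        simp only [one_mul, one_pow, div_one] at this
        rw [this]
        ring
      · have := integral_exp_norm_ge one_pos (norm_nonneg x)
        simp only [one_mul, div_one] at this ⊢
        rw [this]
    simp_rw [h2]
    rw [Finset.prod_mul_distrib]
    have h3 : Real.exp (-(((n : ℝ) + 1) * ‖x‖ ^ 2))
        = Real.exp (-‖x‖ ^ 2) ^ n * Real.exp (-‖x‖ ^ 2) := by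
      rw [← pow_succ, ← Real.exp_nat_mul]
      push_cast
      ring_nf
    rw [h3]
    simp only [c, Finset.prod_const, Finset.card_univ, Fintype.card_fin, mul_pow]
    induction k using Fin.succAboveCases i with
    | x => simp [Fin.succAbove_ne]; ring
    | p k => simp [(Fin.succAbove_ne _ _).symm, Fin.succAbove_ne]; ring
  have hb : (0 : ℝ) < (n : ℝ) + 1 := by positivity
  have e0 : ∫ x : ℂ, Real.exp (-(((n : ℝ) + 1) * ‖x‖ ^ 2)) = Real.pi * (1 / ((n : ℝ) + 1)) := by
    simpa using integral_exp_norm_ge hb le_rfl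
  have e1 : ∫ x : ℂ, ‖x‖ ^ 2 * Real.exp (-(((n : ℝ) + 1) * ‖x‖ ^ 2))
      = Real.pi * (1 / ((n : ℝ) + 1) ^ 2) := by
    simpa using integral_sq_exp_norm_ge hb le_rfl
  have i1 : Integrable fun x : ℂ => ‖x‖ ^ 2 * Real.exp (-(((n : ℝ) + 1) * ‖x‖ ^ 2)) := by
    by_contra hn
    rw [integral_undef hn] at e1
    have : 0 < Real.pi * (1 / ((n : ℝ) + 1) ^ 2) := by positivity
    linarith
  rw [← hmp.integral_comp' (g := F), integral_congr_ae (Filter.Eventually.of_forall hfac), Measure.volume_eq_prod, integral_prod _ hint2]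
  simp_rw [hinner]
  rw [integral_const_mul]
  split_ifs
  · rw [e1]; ring
  · simp only [one_add_mul]
    rw [integral_add (integrable_exp_neg_norm_sq_complex hb) i1, e0, e1]
    ring

/-! ### Unitary invariance and second moments -/

section Unitary

variable {ι : Type*} [Fintype ι]

theorem sum_norm_sq_eq_dotProduct (z : ι → ℂ) :
    ((∑ k, ‖z k‖ ^ 2 : ℝ) : ℂ) = star z ⬝ᵥ z := by
  simp [dotProduct, Complex.conj_mul']

variable [DecidableEq ι]

theorem sum_norm_sq_unitary_mulVec {U : Matrix ι ι ℂ} (hU : Uᴴ * U = 1) (z : ι → ℂ) :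
    ∑ k, ‖(U *ᵥ z) k‖ ^ 2 = ∑ k, ‖z k‖ ^ 2 := by
  have h : star (U *ᵥ z) ⬝ᵥ (U *ᵥ z) = star z ⬝ᵥ z := by
    rw [Matrix.star_mulVec, ← Matrix.dotProduct_mulVec, Matrix.mulVec_mulVec, hU, Matrix.one_mulVec]
  rw [← sum_norm_sq_eq_dotProduct, ← sum_norm_sq_eq_dotProduct] at h
  exact_mod_cast h

/-- The real determinant of a complex linear map is the squared modulus of its complex determinant,
here `1`. -/
theorem measurePreserving_unitary_mulVec {U : Matrix ι ι ℂ} (hU : Uᴴ * U = 1) :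
    MeasurePreserving (fun z : ι → ℂ => U *ᵥ z) volume volume := by
  have hdet : LinearMap.det ((Matrix.toLin' U).restrictScalars ℝ) = 1 := by
    rw [LinearMap.det_restrictScalars, LinearMap.det_toLin', Algebra.norm_complex_apply]
    have h := congrArg Matrix.det hU
    rw [Matrix.det_mul, Matrix.det_conjTranspose, Matrix.det_one] at h
    have h2 : ((Complex.normSq U.det : ℝ) : ℂ) = 1 := by
      rw [Complex.normSq_eq_conj_mul_self]
      exact h
    exact_mod_cast h2
  refine ⟨by fun_prop, ?_⟩
  have h := Measure.map_linearMap_addHaar_eq_smul_addHaar (volume : Measure (ι → ℂ))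
    (f := (Matrix.toLin' U).restrictScalars ℝ) (by rw [hdet]; exact one_ne_zero)
  rw [hdet] at h
  have h2 : Measure.map (fun z : ι → ℂ => U *ᵥ z) volume
      = ENNReal.ofReal |(1 : ℝ)⁻¹| • (volume : Measure (ι → ℂ)) := h
  simpa using h2

theorem integral_comp_unitary_mulVec {U : Matrix ι ι ℂ} (hU : Uᴴ * U = 1) (g : (ι → ℂ) → ℂ) :
    ∫ z, g (U *ᵥ z) = ∫ z, g z := by
  have hinj : Function.Injective fun z : ι → ℂ => U *ᵥ z := by
    intro z w h
    have := congrArg (fun v => Uᴴ *ᵥ v) h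
    simpa [Matrix.mulVec_mulVec, hU] using this
  exact (measurePreserving_unitary_mulVec hU).integral_comp
    (Continuous.measurableEmbedding (by fun_prop) hinj) g

theorem gaussWeight_unitary_mulVec {U : Matrix ι ι ℂ} (hU : Uᴴ * U = 1) (z : ι → ℂ) :
    gaussWeight (U *ᵥ z) = gaussWeight z := by
  rw [gaussWeight, sum_norm_sq_unitary_mulVec hU, gaussWeight]

/-- Flipping the sign of coordinate `k` is unitary and preserves all moduli, but reverses the sign
of the integrand. -/
theorem integral_entry_eq_zero {f : (ι → ℂ) → ℝ}
    (hf : ∀ z w, (∀ k, ‖z k‖ = ‖w k‖) → f z = f w) {k l : ι} (hkl : k ≠ l) :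
    ∫ z : ι → ℂ, (f z : ℂ) * (z k * star (z l)) * (gaussWeight z : ℂ) = 0 := by
  let s : ι → ℂ := fun j => if j = k then -1 else 1
  have hU : (Matrix.diagonal s)ᴴ * Matrix.diagonal s = 1 := by
    rw [Matrix.diagonal_conjTranspose, Matrix.diagonal_mul_diagonal, ← Matrix.diagonal_one]
    congr 1
    funext j
    by_cases hj : j = k <;> simp [s, hj]
  have h := integral_comp_unitary_mulVec hU
    (fun z => (f z : ℂ) * (z k * star (z l)) * (gaussWeight z : ℂ))
  have h2 : ∀ z : ι → ℂ, (f (Matrix.diagonal s *ᵥ z) : ℂ) *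
      ((Matrix.diagonal s *ᵥ z) k * star ((Matrix.diagonal s *ᵥ z) l)) *
      (gaussWeight (Matrix.diagonal s *ᵥ z) : ℂ)
      = -((f z : ℂ) * (z k * star (z l)) * (gaussWeight z : ℂ)) := by
    intro z
    have h3 : f (Matrix.diagonal s *ᵥ z) = f z := by
      refine hf _ _ fun j => ?_
      by_cases hj : j = k <;> simp [Matrix.mulVec_diagonal, s, hj]
    rw [gaussWeight_unitary_mulVec hU, h3]
    simp [Matrix.mulVec_diagonal, s, hkl.symm]
  simp_rw [h2] at h
  rw [integral_neg] at h
  exact self_eq_neg.mp h.symm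

/-- Substituting `U z` for `z` conjugates the diagonal moment matrix by `U`. This transports the
computation in the standard basis to an arbitrary orthonormal basis. -/
theorem integral_entry_comp_unitary {f : (ι → ℂ) → ℝ} (hf : Measurable f) (h0 : ∀ z, 0 ≤ f z)
    (h1 : ∀ z, f z ≤ 1) {m : ι → ℂ}
    (hm : ∀ a b, ∫ z : ι → ℂ, (f z : ℂ) * (z a * star (z b)) * (gaussWeight z : ℂ)
      = if a = b then m a else 0)
    {U : Matrix ι ι ℂ} (hU : Uᴴ * U = 1) (k l : ι) :
    ∫ z : ι → ℂ, (f (Uᴴ *ᵥ z) : ℂ) * (z k * star (z l)) * (gaussWeight z : ℂ)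
      = ∑ a, U k a * m a * star (U l a) := by
  rw [← integral_comp_unitary_mulVec hU]
  have h : ∀ z : ι → ℂ, (f (Uᴴ *ᵥ (U *ᵥ z)) : ℂ) * ((U *ᵥ z) k * star ((U *ᵥ z) l)) *
      (gaussWeight (U *ᵥ z) : ℂ) = ∑ a, ∑ b, U k a * star (U l b) *
        ((f z : ℂ) * (z a * star (z b)) * (gaussWeight z : ℂ)) := by
    intro z
    rw [gaussWeight_unitary_mulVec hU, Matrix.mulVec_mulVec, hU, Matrix.one_mulVec]
    simp only [Matrix.mulVec, dotProduct, star_sum, Finset.mul_sum,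
      Finset.sum_mul, star_mul']
    rw [Finset.sum_comm]
    refine Finset.sum_congr rfl fun a _ => Finset.sum_congr rfl fun b _ => ?_
    ring
  simp_rw [h]
  rw [integral_finsetSum _ fun a _ => integrable_finsetSum _ fun b _ =>
    (integrable_entry hf h0 h1 a b).const_mul _]
  refine Finset.sum_congr rfl fun a _ => ?_
  rw [integral_finsetSum _ fun b _ => (integrable_entry hf h0 h1 a b).const_mul _]
  simp_rw [integral_const_mul, hm]
  simp
  ring

end Unitary

/-- The moment matrix of the cell of `i` is a multiple of `(1 + 1/d) 𝟙 - |i⟩⟨i|`, the shape of the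
conditional states of the critical Werner state. -/
theorem integral_minIndicator_entry {d : ℕ} (i a b : Fin d) :
    ∫ z : Fin d → ℂ, (minIndicator i z : ℂ) * (z a * star (z b)) * (gaussWeight z : ℂ)
      = if a = b then (Real.pi : ℂ) ^ d / d * (1 + 1 / d - if a = i then 1 else 0) else 0 := by
  by_cases hab : a = b
  · subst hab
    rw [if_pos rfl]
    obtain ⟨n, rfl⟩ : ∃ n, d = n + 1 := Nat.exists_eq_succ_of_ne_zero (Fin.pos i).ne'
    have h := congrArg (fun x : ℝ => (x : ℂ)) (integral_minIndicator_norm_sq n i a)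
    simp only [← integral_complex_ofReal] at h
    have h2 : ∀ z : Fin (n + 1) → ℂ, (minIndicator i z : ℂ) * (z a * star (z a)) *
        (gaussWeight z : ℂ) = ((minIndicator i z * ‖z a‖ ^ 2 * gaussWeight z : ℝ) : ℂ) := by
      intro z
      simp [Complex.mul_conj']
    simp_rw [h2]
    rw [h]
    have hn : (n : ℂ) + 1 ≠ 0 := by exact_mod_cast n.succ_ne_zero
    split_ifs <;> push_cast <;> field_simp <;> ring
  · rw [if_neg hab]
    refine integral_entry_eq_zero (fun z w h => ?_) hab
    simp [minIndicator, h]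

theorem integral_entry_gaussWeight {d : ℕ} (a b : Fin d) :
    ∫ z : Fin d → ℂ, (z a * star (z b)) * (gaussWeight z : ℂ)
      = if a = b then (Real.pi : ℂ) ^ d else 0 := by
  split_ifs with hab
  · subst hab
    have h := congrArg (fun x : ℝ => (x : ℂ)) (integral_norm_sq_gaussWeight a)
    simp only [← integral_complex_ofReal] at h
    simpa [Complex.mul_conj'] using h
  · simpa using integral_entry_eq_zero (f := fun _ => 1) (fun _ _ _ => rfl) hab

/-! ### The hidden states of Werner's model -/

/-- The distribution of the hidden variable: a size-biased Gaussian vector. -/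
noncomputable def hiddenMeasure (d : ℕ) : Measure (Fin d → ℂ) :=
  volume.withDensity fun z =>
    ENNReal.ofReal ((∑ k, ‖z k‖ ^ 2) * gaussWeight z / (d * Real.pi ^ d))

/-- The pure state along `z`. -/
noncomputable def hiddenState (d : ℕ) (z : Fin d → ℂ) : Matrix (Fin d) (Fin d) ℂ :=
  open Classical in
  -- The maximally mixed state at `0` is a default that makes every value a density matrix; the
  -- size-biased density vanishes there.
  if z = 0 then (1 / (d : ℂ)) • 1 else (1 / ((∑ k, ‖z k‖ ^ 2 : ℝ) : ℂ)) • Matrix.vecMulVec z (star z)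

theorem measurable_hiddenState (d : ℕ) (k l : Fin d) :
    Measurable fun z => hiddenState d z k l := by
  have h : (fun z => hiddenState d z k l) = fun z => open Classical in
      if z = 0 then ((1 / (d : ℂ)) • (1 : Matrix (Fin d) (Fin d) ℂ)) k l
      else (1 / ((∑ k, ‖z k‖ ^ 2 : ℝ) : ℂ)) * (z k * star (z l)) := by
    funext z
    unfold hiddenState
    split_ifs <;> simp [Matrix.vecMulVec_apply]
  rw [h]
  refine Measurable.ite (measurableSet_singleton 0) measurable_const ?_
  refine Measurable.mul ?_ ?_
  · exact measurable_const.div (Complex.measurable_ofReal.comp (by fun_prop))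
  · exact (measurable_pi_apply k).mul (continuous_star.measurable.comp (measurable_pi_apply l))

theorem isDensity_hiddenState {d : ℕ} (hd : d ≠ 0) (z : Fin d → ℂ) :
    IsDensity (hiddenState d z) := by
  unfold hiddenState
  split_ifs with h
  · refine ⟨Matrix.PosSemidef.one.smul (by positivity), ?_⟩
    simp [hd]
  · have hs : star z ⬝ᵥ z ≠ 0 := by simpa using h
    refine ⟨(Matrix.posSemidef_vecMulVec_self_star z).smul ?_, ?_⟩
    · rw [← Complex.ofReal_one, ← Complex.ofReal_div, Complex.zero_le_real]
      positivity
    · rw [Matrix.trace_smul, Matrix.trace_vecMulVec, sum_norm_sq_eq_dotProduct,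
        dotProduct_comm z, smul_eq_mul, one_div, inv_mul_cancel₀ hs]

theorem measurable_hiddenDensity (d : ℕ) : Measurable fun z : Fin d → ℂ =>
    ENNReal.ofReal ((∑ k, ‖z k‖ ^ 2) * gaussWeight z / (d * Real.pi ^ d)) :=
  ENNReal.measurable_ofReal.comp
    (((show Measurable fun z : Fin d → ℂ => ∑ k, ‖z k‖ ^ 2 by fun_prop).mul
      measurable_gaussWeight).div_const _)

/-- The size bias `∑ ‖z k‖ ^ 2` of the measure cancels the normalisation of the pure state, so
averages of hidden states are plain Gaussian second moments. -/
theorem integral_hiddenState {d : ℕ} (f : (Fin d → ℂ) → ℝ) (k l : Fin d) :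
    ∫ z, (f z : ℂ) * hiddenState d z k l ∂hiddenMeasure d
      = (1 / (d * (Real.pi : ℂ) ^ d)) *
        ∫ z : Fin d → ℂ, (f z : ℂ) * (z k * star (z l)) * (gaussWeight z : ℂ) := by
  rw [hiddenMeasure, integral_withDensity_eq_integral_toReal_smul (measurable_hiddenDensity d)
    (Filter.Eventually.of_forall fun z => ENNReal.ofReal_lt_top), ← integral_const_mul]
  congr 1
  funext z
  have hg : 0 ≤ (∑ k, ‖z k‖ ^ 2) * gaussWeight z / (d * Real.pi ^ d) := by
    have := (Real.exp_pos (-∑ k, ‖z k‖ ^ 2)).le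
    unfold gaussWeight
    positivity
  rw [ENNReal.toReal_ofReal hg, Complex.real_smul]
  by_cases hz : z = 0
  · simp [hz]
  · have hs : ((∑ k, ‖z k‖ ^ 2 : ℝ) : ℂ) ≠ 0 := by
      rw [sum_norm_sq_eq_dotProduct]
      simpa using hz
    rw [hiddenState, if_neg hz, Matrix.smul_apply, Matrix.vecMulVec_apply, smul_eq_mul,
      Complex.ofReal_div, Complex.ofReal_mul]
    push_cast at hs ⊢
    simp only [Pi.star_apply]
    field_simp

theorem integral_hiddenState_one {d : ℕ} (k l : Fin d) :
    ∫ z, hiddenState d z k l ∂hiddenMeasure d = ((1 / (d : ℂ)) • (1 : Matrix (Fin d) (Fin d) ℂ)) k l := by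
  have h := integral_hiddenState (fun _ => 1) k l
  simp only [Complex.ofReal_one, one_mul] at h
  rw [h, integral_entry_gaussWeight]
  have hpi : (Real.pi : ℂ) ≠ 0 := by exact_mod_cast Real.pi_ne_zero
  have hd : (d : ℂ) ≠ 0 := by exact_mod_cast (Fin.pos k).ne'
  rw [Matrix.smul_apply, Matrix.one_apply]
  split_ifs <;> simp
  field_simp

theorem isProbabilityMeasure_hiddenMeasure {d : ℕ} (hd : d ≠ 0) :
    IsProbabilityMeasure (hiddenMeasure d) := by
  have hdR : (d : ℝ) ≠ 0 := by exact_mod_cast hd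
  have hk : ∀ k : Fin d, Integrable fun z : Fin d → ℂ => ‖z k‖ ^ 2 * gaussWeight z := by
    intro k
    by_contra hn
    have := integral_norm_sq_gaussWeight k
    rw [integral_undef hn] at this
    exact (pow_pos Real.pi_pos _).ne this
  have hint : ∫ z : Fin d → ℂ, (∑ k, ‖z k‖ ^ 2) * gaussWeight z / (d * Real.pi ^ d) = 1 := by
    simp_rw [Finset.sum_mul]
    rw [integral_div, integral_finsetSum _ fun k _ => hk k]
    simp_rw [integral_norm_sq_gaussWeight]
    simp [hd]
  refine ⟨?_⟩
  rw [hiddenMeasure, withDensity_apply _ MeasurableSet.univ, Measure.restrict_univ,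
    ← ofReal_integral_eq_lintegral_ofReal, hint, ENNReal.ofReal_one]
  · by_contra hn
    rw [integral_undef hn] at hint
    exact zero_ne_one hint
  · refine Filter.Eventually.of_forall fun z => ?_
    have := (Real.exp_pos (-∑ k, ‖z k‖ ^ 2)).le
    simp only [Pi.zero_apply]
    unfold gaussWeight
    positivity

/-- A hidden-state ensemble for `ρ` together with a response to the "yes" outcome of every effect;
the responses to the effects of a measurement need not add up to one. -/
structure EffectModel {m n : Type*} [Fintype m] [DecidableEq m] [Fintype n] [DecidableEq n]
    (ρ : Matrix (m × n) (m × n) ℂ) where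
  Var : Type
  space : MeasurableSpace Var
  μ : Measure Var
  prob : IsProbabilityMeasure μ
  state : Var → Matrix n n ℂ
  measurable_state : ∀ i j, Measurable fun l => state l i j
  density : ∀ l, IsDensity (state l)
  average : ∀ i j, ∫ l, state l i j ∂μ = ptraceA ρ i j
  response : ∀ N : Matrix m m ℂ, N.PosSemidef → ∃ R : Var → ℝ, Measurable R ∧ (∀ l, 0 ≤ R l) ∧
    (∀ l, R l ≤ N.trace.re) ∧
    ∀ i j, ∫ l, (R l : ℂ) * state l i j ∂μ = ptraceA ((N ⊗ₖ (1 : Matrix n n ℂ)) * ρ) i j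

/-- Diagonalise `N` and weight the minimal-overlap cell of each eigenvector by its eigenvalue. Each
cell contributes `(1 + 1/d) 𝟙` minus its eigenprojector, and the weighted sum rebuilds `N`;
indicators are at most one, whence the bound by the trace. -/
theorem exists_response {d : ℕ} {N : Matrix (Fin d) (Fin d) ℂ} (hN : N.PosSemidef) :
    ∃ R : (Fin d → ℂ) → ℝ, Measurable R ∧ (∀ z, 0 ≤ R z) ∧ (∀ z, R z ≤ N.trace.re) ∧
      ∀ k l, ∫ z, (R z : ℂ) * hiddenState d z k l ∂hiddenMeasure d
        = (1 / (d : ℂ) ^ 2) * ((1 + 1 / d) * N.trace * (1 : Matrix (Fin d) (Fin d) ℂ) k l - N k l) := by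
  set U : Matrix (Fin d) (Fin d) ℂ := (hN.isHermitian.eigenvectorUnitary).1
  set η := hN.isHermitian.eigenvalues with hη
  have hU1 : Uᴴ * U = 1 := Unitary.coe_star_mul_self hN.isHermitian.eigenvectorUnitary
  have hU2 : U * Uᴴ = 1 := Unitary.coe_mul_star_self hN.isHermitian.eigenvectorUnitary
  have hη0 : ∀ i, 0 ≤ η i := hN.eigenvalues_nonneg
  have hspec : ∀ k l, N k l = ∑ i, U k i * η i * star (U l i) := by
    intro k l
    conv_lhs => rw [hN.isHermitian.spectral_theorem, Unitary.conjStarAlgAut_apply]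
    rw [Matrix.mul_apply]
    simp [Matrix.mul_diagonal, Matrix.star_apply, U, η]
  have htr : N.trace = ((∑ i, η i : ℝ) : ℂ) := by
    rw [hN.isHermitian.trace_eq_sum_eigenvalues]
    push_cast
    rfl
  have hind : ∀ i, Measurable fun z : Fin d → ℂ => minIndicator i (Uᴴ *ᵥ z) := fun i =>
    (measurable_minIndicator i).comp (by fun_prop)
  refine ⟨fun z => ∑ i, η i * minIndicator i (Uᴴ *ᵥ z), ?_, ?_, ?_, ?_⟩
  · exact Finset.measurable_sum _ fun i _ => (hind i).const_mul _
  · exact fun z => Finset.sum_nonneg fun i _ => mul_nonneg (hη0 i) (minIndicator_nonneg _ _)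
  · intro z
    rw [htr, Complex.ofReal_re]
    exact Finset.sum_le_sum fun i _ => mul_le_of_le_one_right (hη0 i) (minIndicator_le_one _ _)
  · intro k l
    rw [integral_hiddenState]
    have h1 : ∀ z : Fin d → ℂ, ((∑ i, η i * minIndicator i (Uᴴ *ᵥ z) : ℝ) : ℂ)
        * (z k * star (z l)) * (gaussWeight z : ℂ) = ∑ i, (η i : ℂ) *
          ((minIndicator i (Uᴴ *ᵥ z) : ℂ) * (z k * star (z l)) * (gaussWeight z : ℂ)) := by
      intro z
      push_cast
      simp only [Finset.sum_mul]
      exact Finset.sum_congr rfl fun i _ => by ring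
    simp_rw [h1]
    rw [integral_finsetSum _ fun i _ => (integrable_entry (hind i)
      (fun z => minIndicator_nonneg _ _) (fun z => minIndicator_le_one _ _) k l).const_mul _]
    have hone : (1 : Matrix (Fin d) (Fin d) ℂ) k l = ∑ a, U k a * star (U l a) := by
      rw [← hU2, Matrix.mul_apply]
      rfl
    have h2 : ∀ i, ∑ a, U k a * ((Real.pi : ℂ) ^ d / d * (1 + 1 / d - if a = i then 1 else 0))
        * star (U l a) = (Real.pi : ℂ) ^ d / d *
          ((1 + 1 / d) * (1 : Matrix (Fin d) (Fin d) ℂ) k l - U k i * star (U l i)) := by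
      intro i
      rw [hone, Finset.mul_sum]
      have : U k i * star (U l i) = ∑ a, (if a = i then 1 else 0) * (U k a * star (U l a)) := by
        simp
      rw [this, ← Finset.sum_sub_distrib, Finset.mul_sum]
      exact Finset.sum_congr rfl fun a _ => by ring
    simp_rw [integral_const_mul, integral_entry_comp_unitary (measurable_minIndicator _)
      (minIndicator_nonneg _) (minIndicator_le_one _) (integral_minIndicator_entry _) hU1, h2]
    have hpi : (Real.pi : ℂ) ≠ 0 := by exact_mod_cast Real.pi_ne_zero
    have hd : (d : ℂ) ≠ 0 := by exact_mod_cast (Fin.pos k).ne'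
    rw [hspec, htr]
    push_cast
    generalize (1 : Matrix (Fin d) (Fin d) ℂ) k l = δ
    simp only [Finset.mul_sum, Finset.sum_mul, mul_sub, Finset.sum_sub_distrib]
    congr 1 <;> refine Finset.sum_congr rfl fun i _ => ?_ <;> field_simp

/-- The Werner state is a combination of the identity and the swap, and the partial trace of `(N ⊗
𝟙)` times the swap is `N` itself. -/
theorem ptraceA_mul_werner (d : ℕ) (α : ℝ) (N : Matrix (Fin d) (Fin d) ℂ) (k l : Fin d) :
    ptraceA ((N ⊗ₖ (1 : Matrix (Fin d) (Fin d) ℂ)) * werner d α) k l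
      = ((α * (2 / ((d : ℝ) * ((d : ℝ) - 1))) * (1 / 2) : ℝ) : ℂ) *
          (N.trace * (1 : Matrix (Fin d) (Fin d) ℂ) k l - N k l)
        + (((1 - α) * (1 / (d : ℝ) ^ 2) : ℝ) : ℂ) *
          (N.trace * (1 : Matrix (Fin d) (Fin d) ℂ) k l) := by
  have hS : ptraceA ((N ⊗ₖ (1 : Matrix (Fin d) (Fin d) ℂ)) * swapOp d) k l = N k l := by
    simp [ptraceA, swapOp, Matrix.mul_apply, Fintype.sum_prod_type, Matrix.one_apply, Prod.ext_iff,
      ite_and]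
  have h1 : ptraceA ((N ⊗ₖ (1 : Matrix (Fin d) (Fin d) ℂ)) * 1) k l
      = N.trace * (1 : Matrix (Fin d) (Fin d) ℂ) k l := by
    simp [ptraceA, Matrix.trace, Finset.sum_mul]
  rw [← h1, ← hS]
  simp only [ptraceA, werner, antiProj, Matrix.mul_add, Matrix.mul_sub, Matrix.mul_smul,
    Matrix.of_apply, Matrix.add_apply, Matrix.sub_apply, Matrix.smul_apply, Complex.real_smul,
    Finset.sum_add_distrib, Finset.sum_sub_distrib, ← Finset.mul_sum]
  push_cast
  ring

/-- The assemblage of the Werner state at Werner's critical weight. -/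
theorem ptraceA_mul_werner_critical {d : ℕ} (hd : 2 ≤ d) (N : Matrix (Fin d) (Fin d) ℂ)
    (k l : Fin d) :
    ptraceA ((N ⊗ₖ (1 : Matrix (Fin d) (Fin d) ℂ)) * werner d (((d : ℝ) - 1) / d)) k l
      = (1 / (d : ℂ) ^ 2) * ((1 + 1 / d) * N.trace * (1 : Matrix (Fin d) (Fin d) ℂ) k l - N k l) := by
  rw [ptraceA_mul_werner]
  have hd0 : (d : ℂ) ≠ 0 := by exact_mod_cast (by omega : d ≠ 0)
  have hd1 : (d : ℂ) - 1 ≠ 0 := by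
    rw [sub_ne_zero]
    exact_mod_cast (by omega : d ≠ 1)
  push_cast
  field_simp
  ring

theorem ptraceA_werner {d : ℕ} (hd : 2 ≤ d) :
    ptraceA (werner d (((d : ℝ) - 1) / d)) = (1 / (d : ℂ)) • 1 := by
  ext k l
  have h := ptraceA_mul_werner_critical hd 1 k l
  have hd0 : (d : ℂ) ≠ 0 := by exact_mod_cast (by omega : d ≠ 0)
  rw [Matrix.one_kronecker_one, Matrix.one_mul] at h
  rw [h]
  simp
  field_simp
  ring

/-- Werner's local hidden state model. -/
noncomputable def wernerModel {d : ℕ} (hd : 2 ≤ d) :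
    EffectModel (werner d (((d : ℝ) - 1) / d)) where
  Var := Fin d → ℂ
  space := inferInstance
  μ := hiddenMeasure d
  prob := isProbabilityMeasure_hiddenMeasure (by omega)
  state := hiddenState d
  measurable_state := measurable_hiddenState d
  density := isDensity_hiddenState (by omega)
  average k l := by rw [integral_hiddenState_one, ptraceA_werner hd]
  response N hN := by
    simp_rw [ptraceA_mul_werner_critical hd]
    exact exists_response hN

/-! ### Density matrices and flag extensions -/

/-- The principal `2 × 2` minor is nonnegative and diagonal entries lie in `[0, 1]`. The case `i =
j` is included, as a degenerate minor. -/
theorem IsDensity.norm_apply_le_one {n : Type*} [Fintype n] {τ : Matrix n n ℂ} (h : IsDensity τ)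
    (i j : n) : ‖τ i j‖ ≤ 1 := by
  have hd0 : ∀ k, 0 ≤ (τ k k).re := fun k => (Complex.nonneg_iff.mp h.1.diag_nonneg).1
  have hdi : ∀ k, τ k k = ((τ k k).re : ℂ) := fun k =>
    Complex.ext rfl (Complex.nonneg_iff.mp (h.1.diag_nonneg (i := k))).2.symm
  have hd1 : ∀ k, (τ k k).re ≤ 1 := by
    intro k
    have ht : ∑ k, (τ k k).re = 1 := by
      have := congrArg Complex.re h.2
      simpa [Matrix.trace] using this
    rw [← ht]
    exact Finset.single_le_sum (f := fun k => (τ k k).re) (fun k _ => hd0 k) (Finset.mem_univ k)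
  have hdet := (h.1.submatrix ![i, j]).det_nonneg
  rw [Matrix.det_fin_two] at hdet
  simp only [Matrix.submatrix_apply, Matrix.cons_val_zero, Matrix.cons_val_one] at hdet
  rw [← h.1.isHermitian.apply j i, hdi i, hdi j, Complex.star_def, Complex.mul_conj'] at hdet
  have h2 : 0 ≤ (τ i i).re * (τ j j).re - ‖τ i j‖ ^ 2 := by exact_mod_cast hdet
  have h3 : (τ i i).re * (τ j j).re ≤ 1 * 1 :=
    mul_le_mul (hd1 i) (hd1 j) (hd0 j) zero_le_one
  nlinarith [norm_nonneg (τ i j)]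

theorem integrable_mul_density {Λ n : Type*} [Fintype n] [MeasurableSpace Λ] {μ : Measure Λ}
    [IsFiniteMeasure μ] {p : Λ → ℝ} {τ : Λ → Matrix n n ℂ} {C : ℝ} (hp : Measurable p)
    (h0 : ∀ l, 0 ≤ p l) (hC : ∀ l, p l ≤ C) (hτ : ∀ i j, Measurable fun l => τ l i j)
    (hd : ∀ l, IsDensity (τ l)) (i j : n) : Integrable (fun l => (p l : ℂ) * τ l i j) μ := by
  refine Integrable.of_bound
    ((Complex.measurable_ofReal.comp hp).mul (hτ i j)).aestronglyMeasurable C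
    (Filter.Eventually.of_forall fun l => ?_)
  rw [norm_mul, Complex.norm_real, Real.norm_eq_abs, abs_of_nonneg (h0 l)]
  calc p l * ‖τ l i j‖ ≤ C * 1 :=
        mul_le_mul (hC l) ((hd l).norm_apply_le_one i j) (norm_nonneg _) ((h0 l).trans (hC l))
    _ = C := mul_one C

theorem ptraceA_kronecker_one_mul_apply {m n : Type*} [Fintype m] [Fintype n] [DecidableEq n]
    (A : Matrix m m ℂ) (ω : Matrix (m × n) (m × n) ℂ) (i j : n) :
    ptraceA ((A ⊗ₖ (1 : Matrix n n ℂ)) * ω) i j = ∑ a, ∑ b, A a b * ω (b, i) (a, j) := by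
  simp [ptraceA, Matrix.mul_apply, Fintype.sum_prod_type, Matrix.one_apply]

section Flag

variable {m n : Type*} [Fintype m] [DecidableEq m] [Fintype n] [DecidableEq n]

omit [Fintype m] in
@[simp] theorem incl_inl (a b : m) : incl m (Sum.inl a) b = (1 : Matrix m m ℂ) a b := rfl

omit [Fintype m] in
@[simp] theorem incl_inr (u : Unit) (b : m) : incl m (Sum.inr u) b = 0 := rfl

theorem flagA_inl_inl (ρ : Matrix (m × n) (m × n) ℂ) (a b : m) (i j : n) :
    flagA ρ (Sum.inl a, i) (Sum.inl b, j) = 1 / ((Fintype.card m : ℂ) + 1) * ρ (a, i) (b, j) := by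
  simp [flagA, Matrix.mul_apply, Fintype.sum_prod_type, flagProj, Matrix.one_apply,
    apply_ite (starRingEnd ℂ)]

theorem flagA_inl_inr (ρ : Matrix (m × n) (m × n) ℂ) (a : m) (u : Unit) (i j : n) :
    flagA ρ (Sum.inl a, i) (Sum.inr u, j) = 0 := by
  simp [flagA, Matrix.mul_apply, flagProj]

theorem flagA_inr_inl (ρ : Matrix (m × n) (m × n) ℂ) (a : m) (u : Unit) (i j : n) :
    flagA ρ (Sum.inr u, i) (Sum.inl a, j) = 0 := by
  simp [flagA, Matrix.mul_apply, flagProj]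

theorem flagA_inr_inr (ρ : Matrix (m × n) (m × n) ℂ) (u v : Unit) (i j : n) :
    flagA ρ (Sum.inr u, i) (Sum.inr v, j)
      = Fintype.card m / ((Fintype.card m : ℂ) + 1) * ptraceA ρ i j := by
  simp [flagA, Matrix.mul_apply, flagProj]
  ring

/-- The flagged state has no coherence between system and flag, so the off-diagonal blocks of the
effect drop out. -/
theorem ptraceA_mul_flagA (ρ : Matrix (m × n) (m × n) ℂ) (N : Matrix (m ⊕ Unit) (m ⊕ Unit) ℂ)
    (i j : n) :
    ptraceA ((N ⊗ₖ (1 : Matrix n n ℂ)) * flagA ρ) i j = 1 / ((Fintype.card m : ℂ) + 1) *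
      (ptraceA ((N.toBlocks₁₁ ⊗ₖ (1 : Matrix n n ℂ)) * ρ) i j
        + Fintype.card m * N (Sum.inr ()) (Sum.inr ()) * ptraceA ρ i j) := by
  rw [ptraceA_kronecker_one_mul_apply, ptraceA_kronecker_one_mul_apply]
  simp only [Fintype.sum_sum_type, flagA_inl_inl, flagA_inl_inr, flagA_inr_inl, flagA_inr_inr]
  simp [Matrix.toBlocks₁₁, Finset.mul_sum, mul_add]
  congr 1
  · exact Finset.sum_congr rfl fun s _ => Finset.sum_congr rfl fun t _ => by ring
  · ring

/-- The system blocks of the effects sum to the identity of `ℂ^d`, of trace `d`, so the bounds by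
the trace give total response at most `d`. The normalisation `d + 1` of the flag extension therefore
leaves room to complete the responses to a probability distribution. -/
theorem EffectModel.unsteerableAB_flagA {ρ : Matrix (m × n) (m × n) ℂ} (E : EffectModel ρ) :
    UnsteerableAB (flagA ρ) := by
  intro X k M
  let := E.space
  have := E.prob
  set d : ℝ := (Fintype.card m : ℝ) with hd
  have hd0 : 0 ≤ d := Nat.cast_nonneg _
  have hN : ∀ x a, ((M x).elem a).toBlocks₁₁.PosSemidef := fun x a =>
    ((M x).posSemidef a).submatrix Sum.inl
  choose R hRm hR0 hRle hRint using fun x a => E.response _ (hN x a)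
  let q : ∀ x, Fin (k x) → ℝ := fun x a => ((M x).elem a (Sum.inr ()) (Sum.inr ())).re
  have hq : ∀ x a, (M x).elem a (Sum.inr ()) (Sum.inr ()) = (q x a : ℂ) := fun x a =>
    Complex.ext rfl (Complex.nonneg_iff.mp (((M x).posSemidef a).diag_nonneg)).2.symm
  have hq0 : ∀ x a, 0 ≤ q x a := fun x a =>
    (Complex.nonneg_iff.mp (((M x).posSemidef a).diag_nonneg)).1
  have hentry : ∀ x s t, ∑ a, (M x).elem a s t = (1 : Matrix (m ⊕ Unit) (m ⊕ Unit) ℂ) s t := by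
    intro x s t
    rw [← (M x).sum_eq_one, Matrix.sum_apply]
  have hqsum : ∀ x, ∑ a, q x a = 1 := by
    intro x
    have := congrArg Complex.re (hentry x (Sum.inr ()) (Sum.inr ()))
    simpa [q] using this
  have hNsum : ∀ x, ∑ a, ((M x).elem a).toBlocks₁₁ = 1 := by
    intro x
    ext s t
    rw [Matrix.sum_apply]
    simpa [Matrix.toBlocks₁₁, Matrix.one_apply] using hentry x (Sum.inl s) (Sum.inl t)
  have hRsum : ∀ x l, ∑ a, R x a l ≤ d := by
    intro x l
    calc ∑ a, R x a l ≤ ∑ a, (((M x).elem a).toBlocks₁₁).trace.re :=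
          Finset.sum_le_sum fun a _ => hRle x a l
      _ = d := by
          rw [← Complex.re_sum, ← Matrix.trace_sum, hNsum]
          simp [hd]
  -- The flag entries `q x a` form a probability distribution over outcomes, and they share out the
  -- weight `d + 1 - ∑ b, R x b l` that the responses leave unused.
  refine ⟨E.Var, E.space, E.μ, fun x a l => 1 / (d + 1) *
    (R x a l + q x a * (d + 1 - ∑ b, R x b l)), E.state, E.prob, ?_, ?_, ?_, E.measurable_state,
    E.density, ?_⟩
  · intro x a
    have := hRm x a
    have h2 : Measurable fun l => ∑ b, R x b l := Finset.measurable_sum _ fun b _ => hRm x b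
    fun_prop
  · intro x a l
    have h1 := hRsum x l
    have h2 := hq0 x a
    have h3 := hR0 x a l
    have h4 : 0 ≤ d + 1 - ∑ b, R x b l := by linarith
    positivity
  · intro x l
    rw [← Finset.mul_sum, Finset.sum_add_distrib, ← Finset.sum_mul, hqsum]
    field_simp
    ring
  · intro x a i j
    have hI : ∀ b, Integrable (fun l => (R x b l : ℂ) * E.state l i j) E.μ := fun b =>
      integrable_mul_density (hRm x b) (hR0 x b) (hRle x b) E.measurable_state E.density i j
    have hI1 : Integrable (fun l => E.state l i j) E.μ := by
      simpa using integrable_mul_density (p := fun _ => 1) (C := 1) measurable_const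
        (fun _ => zero_le_one) (fun _ => le_rfl) E.measurable_state E.density i j
    have hsplit : ∀ l, ((1 / (d + 1) * (R x a l + q x a * (d + 1 - ∑ b, R x b l)) : ℝ) : ℂ)
        * E.state l i j = 1 / ((d : ℂ) + 1) * ((R x a l : ℂ) * E.state l i j
          + q x a * (((d : ℂ) + 1) * E.state l i j - ∑ b, (R x b l : ℂ) * E.state l i j)) := by
      intro l
      push_cast
      rw [← Finset.sum_mul]
      ring
    -- Although the responses do not sum to a constant, their averaged states sum to `ρ_B`; the
    -- unused weight then averages to `(d + 1) ρ_B - ρ_B = d ρ_B`.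
    have hsum : ∑ b, ptraceA ((((M x).elem b).toBlocks₁₁ ⊗ₖ (1 : Matrix n n ℂ)) * ρ) i j
        = ptraceA ρ i j := by
      have h1 : ∑ b, ptraceA ((((M x).elem b).toBlocks₁₁ ⊗ₖ (1 : Matrix n n ℂ)) * ρ) i j
          = ptraceA (((∑ b, ((M x).elem b).toBlocks₁₁) ⊗ₖ (1 : Matrix n n ℂ)) * ρ) i j := by
        have h2 : (∑ b, ((M x).elem b).toBlocks₁₁) ⊗ₖ (1 : Matrix n n ℂ)
            = ∑ b, ((M x).elem b).toBlocks₁₁ ⊗ₖ (1 : Matrix n n ℂ) := by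
          ext p q
          simp [Matrix.sum_apply, Finset.sum_mul]
        rw [h2, Finset.sum_mul]
        simp only [ptraceA, Matrix.of_apply, Matrix.sum_apply]
        exact Finset.sum_comm
      rw [h1, hNsum, Matrix.one_kronecker_one, Matrix.one_mul]
    simp_rw [hsplit]
    have hI2 : Integrable (fun l => ((d : ℂ) + 1) * E.state l i j
        - ∑ b, (R x b l : ℂ) * E.state l i j) E.μ :=
      (hI1.const_mul _).sub (integrable_finsetSum _ fun b _ => hI b)
    rw [integral_const_mul, integral_add (hI a) (hI2.const_mul _), integral_const_mul,
      integral_sub (hI1.const_mul _) (integrable_finsetSum _ fun b _ => hI b),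
      integral_const_mul, integral_finsetSum _ fun b _ => hI b, E.average]
    simp_rw [hRint]
    rw [hsum, assemblage, ptraceA_mul_flagA, hq]
    simp only [hd, Complex.ofReal_natCast]
    ring

theorem flagB_inl_inl (ρ : Matrix (m × n) (m × n) ℂ) (a b : m) (i j : n) :
    flagB ρ (a, Sum.inl i) (b, Sum.inl j) = 1 / ((Fintype.card n : ℂ) + 1) * ρ (a, i) (b, j) :=
  flagA_inl_inl (exchange ρ) i j a b

theorem flagB_inl_inr (ρ : Matrix (m × n) (m × n) ℂ) (a b : m) (i : n) (u : Unit) :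
    flagB ρ (a, Sum.inl i) (b, Sum.inr u) = 0 :=
  flagA_inl_inr (exchange ρ) i u a b

theorem flagB_inr_inl (ρ : Matrix (m × n) (m × n) ℂ) (a b : m) (i : n) (u : Unit) :
    flagB ρ (a, Sum.inr u) (b, Sum.inl i) = 0 :=
  flagA_inr_inl (exchange ρ) i u a b

theorem flagB_inr_inr (ρ : Matrix (m × n) (m × n) ℂ) (a b : m) (u v : Unit) :
    flagB ρ (a, Sum.inr u) (b, Sum.inr v)
      = Fintype.card n / ((Fintype.card n : ℂ) + 1) * ∑ i, ρ (a, i) (b, i) :=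
  flagA_inr_inr (exchange ρ) u v a b

/-- The channel that replaces the state by the flag with probability `d / (d + 1)`. -/
noncomputable def flagChannel (τ : Matrix n n ℂ) : Matrix (n ⊕ Unit) (n ⊕ Unit) ℂ :=
  Matrix.fromBlocks ((1 / ((Fintype.card n : ℂ) + 1)) • τ) 0 0
    (Matrix.of fun _ _ => Fintype.card n / ((Fintype.card n : ℂ) + 1) * τ.trace)

omit [DecidableEq n] in
theorem isDensity_flagChannel {τ : Matrix n n ℂ} (h : IsDensity τ) :
    IsDensity (flagChannel τ) := by
  classical
  constructor
  · have h1 : flagChannel τ = (1 / ((Fintype.card n : ℂ) + 1)) • (incl n * τ * (incl n)ᴴ)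
        + ((Fintype.card n : ℂ) / ((Fintype.card n : ℂ) + 1)) •
          Matrix.diagonal (Sum.elim (fun _ => 0) fun _ => 1) := by
      ext (i | i) (j | j) <;>
        simp [flagChannel, Matrix.mul_apply, h.2, Matrix.one_apply, Matrix.diagonal_apply]
    rw [h1]
    have h2 : (0 : ℂ) ≤ 1 / ((Fintype.card n : ℂ) + 1) := by positivity
    have h3 : (0 : ℂ) ≤ (Fintype.card n : ℂ) / ((Fintype.card n : ℂ) + 1) := by positivity
    refine ((h.1.mul_mul_conjTranspose_same _).smul h2).add ((Matrix.PosSemidef.diagonal ?_).smul h3)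
    rintro (i | i) <;> simp
  · have h4 : (Fintype.card n : ℂ) + 1 ≠ 0 := by exact_mod_cast Nat.succ_ne_zero (Fintype.card n)
    have h5 : ∑ i, τ i i = 1 := h.2
    simp [flagChannel, Matrix.trace, ← Finset.mul_sum, h5]
    field_simp
    ring

/-- Flagging Bob's side commutes with Alice's measurements, so the channel can act on the hidden
states. The responses stay the same, and linearity takes the channel through the integral. -/
theorem UnsteerableAB.flagB {ρ : Matrix (m × n) (m × n) ℂ} (h : UnsteerableAB ρ) :
    UnsteerableAB (flagB ρ) := by
  intro X k M
  obtain ⟨Λ, mΛ, μ, p, τ, hμ, hpm, hp0, hp1, hτm, hτ, hσ⟩ := h X k M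
  have hass : ∀ x a, assemblage (Steering.flagB ρ) M x a = flagChannel (assemblage ρ M x a) := by
    intro x a
    ext (i | i) (j | j)
    · simp [assemblage, ptraceA_kronecker_one_mul_apply, flagChannel, flagB_inl_inl, Finset.mul_sum]
      refine Finset.sum_congr rfl fun s _ => Finset.sum_congr rfl fun t _ => ?_
      ring
    · simp [assemblage, ptraceA_kronecker_one_mul_apply, flagChannel, flagB_inl_inr]
    · simp [assemblage, ptraceA_kronecker_one_mul_apply, flagChannel, flagB_inr_inl]
    · simp [assemblage, ptraceA_kronecker_one_mul_apply, flagChannel, flagB_inr_inr, Matrix.trace, Finset.mul_sum]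
      rw [eq_comm, Finset.sum_comm]
      refine Finset.sum_congr rfl fun s _ => ?_
      rw [Finset.sum_comm]
      exact Finset.sum_congr rfl fun t _ => Finset.sum_congr rfl fun i _ => by ring
  refine ⟨Λ, mΛ, μ, p, fun l => flagChannel (τ l), hμ, hpm, hp0, hp1, ?_,
    fun l => isDensity_flagChannel (hτ l), ?_⟩
  · rintro (i | i) (j | j)
    · exact (hτm i j).const_mul _
    · exact measurable_const
    · exact measurable_const
    · exact (Finset.measurable_sum _ fun i _ => hτm i i).const_mul _
  · have hp_le : ∀ x a l, p x a l ≤ 1 := by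
      intro x a l
      rw [← hp1 x l]
      exact Finset.single_le_sum (f := fun a => p x a l) (fun a _ => hp0 x a l) (Finset.mem_univ a)
    rintro x a (i | i) (j | j)
    · rw [hass]
      simp only [flagChannel, Matrix.fromBlocks_apply₁₁, Matrix.smul_apply, smul_eq_mul, hσ,
        ← integral_const_mul]
      congr 1
      funext l
      ring
    · simp [hass, flagChannel]
    · simp [hass, flagChannel]
    · rw [hass]
      simp only [flagChannel, Matrix.fromBlocks_apply₂₂, Matrix.of_apply, Matrix.trace,
        Matrix.diag_apply, hσ]
      rw [← integral_finsetSum _ fun i _ => integrable_mul_density (hpm x a) (hp0 x a)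
        (hp_le x a) hτm hτ i i, ← integral_const_mul]
      congr 1
      funext l
      rw [← Finset.mul_sum]
      ring

end Flag

/-! ### The doubly flagged Werner state -/

section Density

variable {m n : Type*} [Fintype m] [Fintype n]

theorem IsDensity.exchange {ρ : Matrix (m × n) (m × n) ℂ} (h : IsDensity ρ) :
    IsDensity (exchange ρ) := by
  refine ⟨h.1.submatrix _, ?_⟩
  rw [← h.2]
  exact Fintype.sum_equiv (Equiv.prodComm n m) _ _ fun _ => rfl

theorem IsDensity.ptraceA {ρ : Matrix (m × n) (m × n) ℂ} (h : IsDensity ρ) :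
    IsDensity (ptraceA ρ) := by
  constructor
  · have : Steering.ptraceA ρ = ∑ k, ρ.submatrix (fun i => (k, i)) (fun i => (k, i)) := by
      ext i j
      simp [Steering.ptraceA, Matrix.sum_apply]
    rw [this]
    exact Matrix.posSemidef_sum _ fun k _ => h.1.submatrix _
  · rw [← h.2]
    simp only [Matrix.trace, Steering.ptraceA, Matrix.diag_apply, Matrix.of_apply,
      Fintype.sum_prod_type]
    exact Finset.sum_comm

variable [DecidableEq m] [DecidableEq n]

theorem IsDensity.flagA {ρ : Matrix (m × n) (m × n) ℂ} (h : IsDensity ρ) :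
    IsDensity (flagA ρ) := by
  have hP : (flagProj m).PosSemidef := by
    have : flagProj m = Matrix.diagonal (Sum.elim (fun _ => 0) fun _ => 1) := by
      ext (i | i) (j | j) <;> simp [flagProj, Matrix.diagonal_apply]
    rw [this]
    refine Matrix.PosSemidef.diagonal ?_
    rintro (i | i) <;> simp
  constructor
  · unfold Steering.flagA
    refine Matrix.PosSemidef.smul (Matrix.PosSemidef.add (h.1.mul_mul_conjTranspose_same _)
      (Matrix.PosSemidef.smul (hP.kronecker h.ptraceA.1) (by positivity))) (by positivity)
  · have h1 : ∑ a, ∑ i, ρ (a, i) (a, i) = 1 := by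
      rw [← h.2, Matrix.trace, Fintype.sum_prod_type]
      rfl
    have h2 : ∑ i, Steering.ptraceA ρ i i = 1 := h.ptraceA.2
    have h3 : (Fintype.card m : ℂ) + 1 ≠ 0 := by exact_mod_cast Nat.succ_ne_zero (Fintype.card m)
    simp only [Matrix.trace, Matrix.diag_apply, Fintype.sum_prod_type, Fintype.sum_sum_type,
      flagA_inl_inl, flagA_inr_inr, ← Finset.mul_sum, h1, h2]
    simp
    field_simp
    ring

theorem IsDensity.flagB {ρ : Matrix (m × n) (m × n) ℂ} (h : IsDensity ρ) :
    IsDensity (flagB ρ) :=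
  h.exchange.flagA.exchange

end Density

/-! ### Positivity and exchange symmetry of the Werner state -/

theorem swapOp_mul_self (d : ℕ) : swapOp d * swapOp d = 1 := by
  ext ⟨a, b⟩ ⟨a', b'⟩
  simp [swapOp, Matrix.mul_apply, Fintype.sum_prod_type, Matrix.one_apply, Prod.ext_iff, ite_and]

theorem conjTranspose_swapOp (d : ℕ) : (swapOp d)ᴴ = swapOp d := by
  ext ⟨a, b⟩ ⟨a', b'⟩
  simp [swapOp, Prod.ext_iff, apply_ite (starRingEnd ℂ), eq_comm, and_comm]

theorem trace_swapOp (d : ℕ) : (swapOp d).trace = d := by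
  simp [Matrix.trace, swapOp, Fintype.sum_prod_type, Prod.ext_iff, ite_and]

/-- The swap is a Hermitian involution, so `1 - swapOp d` is half of its own square. -/
theorem posSemidef_antiProj (d : ℕ) : (antiProj d).PosSemidef := by
  have h : antiProj d = (1 / 2 : ℝ) • ((1 / 2 : ℝ) • ((1 - swapOp d)ᴴ * (1 - swapOp d)) ):= by
    rw [Matrix.conjTranspose_sub, conjTranspose_swapOp, Matrix.conjTranspose_one, mul_sub, sub_mul,
      sub_mul, swapOp_mul_self, antiProj]
    simp only [Matrix.one_mul, Matrix.mul_one]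
    module
  rw [h]
  exact ((Matrix.posSemidef_conjTranspose_mul_self _).smul (by norm_num)).smul (by norm_num)

theorem isDensity_werner {d : ℕ} (hd : 2 ≤ d) {α : ℝ} (h0 : 0 ≤ α) (h1 : α ≤ 1) :
    IsDensity (werner d α) := by
  have hd' : (2 : ℝ) ≤ d := by exact_mod_cast hd
  constructor
  · refine ((posSemidef_antiProj d).smul ?_).add (Matrix.PosSemidef.one.smul ?_)
    · have : 0 ≤ (d : ℝ) - 1 := by linarith
      positivity
    · have : 0 ≤ 1 - α := by linarith
      positivity
  · have hd0 : (d : ℂ) ≠ 0 := by exact_mod_cast (by omega : d ≠ 0)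
    have hd1 : (d : ℂ) - 1 ≠ 0 := by
      rw [sub_ne_zero]
      exact_mod_cast (by omega : d ≠ 1)
    simp [werner, antiProj, Matrix.trace_add, Matrix.trace_smul, Matrix.trace_sub, trace_swapOp]
    field_simp
    ring

theorem exchange_swapOp (d : ℕ) : exchange (swapOp d) = swapOp d := by
  ext ⟨a, b⟩ ⟨a', b'⟩
  simp [swapOp, exchange, Prod.ext_iff, and_comm]

theorem exchange_werner (d : ℕ) (α : ℝ) : exchange (werner d α) = werner d α := by
  have h1 : exchange (1 : Matrix (Fin d × Fin d) (Fin d × Fin d) ℂ) = 1 :=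
    Matrix.submatrix_one_equiv (Equiv.prodComm _ _)
  have h2 := exchange_swapOp d
  unfold exchange at h1 h2 ⊢
  simp only [werner, antiProj, Matrix.submatrix_add, Matrix.submatrix_smul, Matrix.submatrix_sub,
    Pi.add_apply, Pi.sub_apply, Pi.smul_apply, h1, h2]

theorem incl_kronecker_sandwich_inl {m n : Type*} [Fintype m] [DecidableEq m] [Fintype n]
    [DecidableEq n] (ρ : Matrix (m × n) (m × n) ℂ) (a b : m) (i j : n) :
    ((incl m ⊗ₖ incl n) * ρ * (incl m ⊗ₖ incl n)ᴴ) (Sum.inl a, Sum.inl i) (Sum.inl b, Sum.inl j)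
      = ρ (a, i) (b, j) := by
  simp [Matrix.mul_apply, Fintype.sum_prod_type, Matrix.one_apply, apply_ite (starRingEnd ℂ)]

theorem sum_werner_critical {d : ℕ} (hd : 2 ≤ d) (a b : Fin d) :
    ∑ i, werner d (((d : ℝ) - 1) / d) (a, i) (b, i)
      = (1 / (d : ℂ)) * (1 : Matrix (Fin d) (Fin d) ℂ) a b := by
  have h := congrFun (congrFun (ptraceA_werner hd) a) b
  rw [← exchange_werner] at h
  exact h

/-- Both reduced states of the Werner state are maximally mixed; compare the blocks with and without
flags entry by entry. -/
theorem rhoHS_eq {d : ℕ} (hd : 2 ≤ d) :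
    rhoHS d = (1 / ((d : ℝ) + 1) ^ 2) •
      ((incl (Fin d) ⊗ₖ incl (Fin d)) * werner d (((d : ℝ) - 1) / d) *
          (incl (Fin d) ⊗ₖ incl (Fin d))ᴴ
        + (d : ℝ) •
          (flagProj (Fin d) ⊗ₖ ((1 / (d : ℝ)) • (incl (Fin d) * (incl (Fin d))ᴴ))
            + ((1 / (d : ℝ)) • (incl (Fin d) * (incl (Fin d))ᴴ)) ⊗ₖ flagProj (Fin d))
        + ((d : ℝ) ^ 2) • (flagProj (Fin d) ⊗ₖ flagProj (Fin d))) := by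
  have hd0 : (d : ℂ) ≠ 0 := by exact_mod_cast (by omega : d ≠ 0)
  have hd1 : (d : ℂ) + 1 ≠ 0 := by exact_mod_cast d.succ_ne_zero
  have hI : ∀ a b : Fin d, (incl (Fin d) * (incl (Fin d))ᴴ) (Sum.inl a) (Sum.inl b)
      = (1 : Matrix (Fin d) (Fin d) ℂ) a b := by
    intro a b
    simp [Matrix.mul_apply, Matrix.one_apply, apply_ite (starRingEnd ℂ)]
  have hI2 : ∀ (u : Unit) s, (incl (Fin d) * (incl (Fin d))ᴴ) (Sum.inr u) s = 0 := by
    intro u s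
    simp [Matrix.mul_apply]
  have hI3 : ∀ (u : Unit) s, (incl (Fin d) * (incl (Fin d))ᴴ) s (Sum.inr u) = 0 := by
    intro u s
    simp [Matrix.mul_apply]
  set S := (incl (Fin d) ⊗ₖ incl (Fin d)) * werner d (((d : ℝ) - 1) / d) *
    (incl (Fin d) ⊗ₖ incl (Fin d))ᴴ with hS
  have hSinl : ∀ a b i j, S (Sum.inl a, Sum.inl i) (Sum.inl b, Sum.inl j)
      = werner d (((d : ℝ) - 1) / d) (a, i) (b, j) := fun a b i j =>
    incl_kronecker_sandwich_inl _ a b i j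
  have hz1 : ∀ u s q, S (Sum.inr u, s) q = 0 := fun u s q => by simp [hS, Matrix.mul_apply]
  have hz2 : ∀ u s q, S (s, Sum.inr u) q = 0 := fun u s q => by simp [hS, Matrix.mul_apply]
  have hz3 : ∀ u s q, S q (Sum.inr u, s) = 0 := fun u s q => by simp [hS, Matrix.mul_apply]
  have hz4 : ∀ u s q, S q (s, Sum.inr u) = 0 := fun u s q => by simp [hS, Matrix.mul_apply]
  ext ⟨a | a, i | i⟩ ⟨b | b, j | j⟩ <;>
    simp only [rhoHS, flagB_inl_inl, flagB_inl_inr, flagB_inr_inl, flagB_inr_inr, flagA_inl_inl,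
      flagA_inl_inr, flagA_inr_inl, flagA_inr_inr, Matrix.smul_apply, Matrix.add_apply,
      hSinl, Matrix.kroneckerMap_apply, hI, hI2, hI3, ← Finset.mul_sum,
      sum_werner_critical hd, ptraceA_werner hd]
  all_goals simp [flagProj, hd0, hz1, hz2, hz3, hz4]
  all_goals field_simp

theorem exchange_kronecker {m n : Type*} (A : Matrix m m ℂ) (B : Matrix n n ℂ) :
    exchange (A ⊗ₖ B) = B ⊗ₖ A := by
  ext ⟨i, a⟩ ⟨j, b⟩
  exact mul_comm _ _

theorem exchange_kronecker_sandwich {m n m' n' : Type*} [Fintype m] [Fintype n]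
    (A : Matrix m' m ℂ) (B : Matrix n' n ℂ) (ρ : Matrix (m × n) (m × n) ℂ) :
    exchange ((A ⊗ₖ B) * ρ * (A ⊗ₖ B)ᴴ) = (B ⊗ₖ A) * exchange ρ * (B ⊗ₖ A)ᴴ := by
  have h : (A ⊗ₖ B).submatrix Prod.swap Prod.swap = B ⊗ₖ A := by
    ext ⟨i, a⟩ ⟨j, b⟩
    exact mul_comm _ _
  rw [← h, Matrix.conjTranspose_submatrix]
  rw [exchange, ← Matrix.submatrix_mul_equiv _ _ _ (Equiv.prodComm n m) _,
    ← Matrix.submatrix_mul_equiv _ _ _ (Equiv.prodComm n m) _]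
  rfl

theorem exchange_add {m n : Type*} (ρ σ : Matrix (m × n) (m × n) ℂ) :
    exchange (ρ + σ) = exchange ρ + exchange σ := rfl

theorem exchange_smul {m n : Type*} (c : ℝ) (ρ : Matrix (m × n) (m × n) ℂ) :
    exchange (c • ρ) = c • exchange ρ := rfl

/-- The order of the two extensions hides the symmetry; the closed formula shows it. -/
theorem exchange_rhoHS {d : ℕ} (hd : 2 ≤ d) : exchange (rhoHS d) = rhoHS d := by
  rw [rhoHS_eq hd]
  simp only [exchange_smul, exchange_add, exchange_kronecker_sandwich, exchange_kronecker,
    exchange_werner]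
  rw [add_comm (_ ⊗ₖ flagProj (Fin d))]

theorem isDensity_rhoHS {d : ℕ} (hd : 2 ≤ d) : IsDensity (rhoHS d) := by
  have hd' : (2 : ℝ) ≤ d := by exact_mod_cast hd
  refine (isDensity_werner hd (div_nonneg (by linarith) (by linarith)) ?_).flagA.flagB
  rw [div_le_one (by linarith)]
  linarith

theorem unsteerableAB_rhoHS {d : ℕ} (hd : 2 ≤ d) : UnsteerableAB (rhoHS d) :=
  (wernerModel hd).unsteerableAB_flagA.flagB

theorem unsteerableBA_rhoHS {d : ℕ} (hd : 2 ≤ d) : UnsteerableBA (rhoHS d) := by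
  rw [UnsteerableBA, exchange_rhoHS hd]
  exact unsteerableAB_rhoHS hd

/-! ### Steering of the two-qubit Werner state -/

/-- The Pauli matrices. -/
noncomputable def pauli : Fin 3 → Matrix (Fin 2) (Fin 2) ℂ :=
  ![!![0, 1; 1, 0], !![0, -Complex.I; Complex.I, 0], !![1, 0; 0, -1]]

/-- The isometry `|k⟩ ↦ |e k⟩`. -/
def embed {m : Type*} [DecidableEq m] (e : Fin 2 → m) : Matrix m (Fin 2) ℂ :=
  (1 : Matrix m m ℂ).submatrix id e

section Embed

variable {m : Type*} [DecidableEq m] {e : Fin 2 → m}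

theorem embed_conjTranspose_mul_self [Fintype m] (he : Function.Injective e) :
    (embed e)ᴴ * embed e = 1 := by
  ext i j
  simp [embed, Matrix.mul_apply, Matrix.one_apply, he.eq_iff]

theorem embed_sandwich_submatrix (he : Function.Injective e) (N : Matrix (Fin 2) (Fin 2) ℂ) :
    (embed e * N * (embed e)ᴴ).submatrix e e = N := by
  ext i j
  simp [embed, Matrix.mul_apply, Matrix.one_apply, he.eq_iff]

/-- The embedded state lives on the qubit subspaces, so it sees only the qubit block of an effect.
-/
theorem ptraceA_mul_embed_sandwich [Fintype m] (he : Function.Injective e)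
    (N : Matrix m m ℂ) (ω : Matrix (Fin 2 × Fin 2) (Fin 2 × Fin 2) ℂ) (i j : Fin 2) :
    ptraceA ((N ⊗ₖ (1 : Matrix m m ℂ)) * ((embed e ⊗ₖ embed e) * ω * (embed e ⊗ₖ embed e)ᴴ))
      (e i) (e j) = ptraceA ((N.submatrix e e ⊗ₖ (1 : Matrix (Fin 2) (Fin 2) ℂ)) * ω) i j := by
  have h : ∀ s t, ((embed e ⊗ₖ embed e) * ω * (embed e ⊗ₖ embed e)ᴴ) (s, e i) (t, e j)
      = ∑ k, ∑ l, (if s = e k then 1 else 0) * (if t = e l then 1 else 0) * ω (k, i) (l, j) := by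
    intro s t
    have hi : ∀ k, (embed e) (e i) k = if k = i then 1 else 0 := fun k => by
      simp [embed, Matrix.one_apply, he.eq_iff, eq_comm]
    have hj : ∀ k, (embed e) (e j) k = if k = j then 1 else 0 := fun k => by
      simp [embed, Matrix.one_apply, he.eq_iff, eq_comm]
    have hs : ∀ s k, (embed e) s k = if s = e k then 1 else 0 := fun s k => by
      simp [embed, Matrix.one_apply]
    simp only [Matrix.mul_apply, Matrix.conjTranspose_apply, Matrix.kroneckerMap_apply,
      Fintype.sum_prod_type, hi, hj]
    rw [Finset.sum_comm]
    fin_cases i <;> fin_cases j <;> simp [hs, Fin.sum_univ_two] <;>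
      split_ifs <;> ring
  rw [ptraceA_kronecker_one_mul_apply, ptraceA_kronecker_one_mul_apply]
  simp only [h]
  simp [Fin.sum_univ_two, mul_add, Finset.sum_add_distrib]
  ring

end Embed

/-! ### Pauli measurements and the three-setting steering inequality -/

theorem pauli_mul_self (x : Fin 3) : pauli x * pauli x = 1 := by
  fin_cases x <;> ext i j <;> fin_cases i <;> fin_cases j <;> simp [pauli]

theorem conjTranspose_pauli (x : Fin 3) : (pauli x)ᴴ = pauli x := by
  fin_cases x <;> ext i j <;> fin_cases i <;> fin_cases j <;> simp [pauli]

theorem trace_pauli (x : Fin 3) : (pauli x).trace = 0 := by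
  fin_cases x <;> simp [pauli, Matrix.trace_fin_two]

/-- The projector on the positive eigenvector of a Pauli matrix. -/
noncomputable def pauliProj (x : Fin 3) : Matrix (Fin 2) (Fin 2) ℂ :=
  (1 / 2 : ℂ) • (1 + pauli x)

theorem pauliProj_mul_self (x : Fin 3) : pauliProj x * pauliProj x = pauliProj x := by
  simp only [pauliProj, Matrix.smul_mul, Matrix.mul_smul, mul_add, add_mul, pauli_mul_self,
    mul_one, one_mul]
  module

theorem conjTranspose_pauliProj (x : Fin 3) : (pauliProj x)ᴴ = pauliProj x := by
  simp [pauliProj, conjTranspose_pauli]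

/-- The dichotomic measurement of an orthogonal projector. -/
noncomputable def projPOVM {m : Type*} [Fintype m] [DecidableEq m] (P : Matrix m m ℂ)
    (h1 : P * P = P) (h2 : Pᴴ = P) : POVM 2 m where
  elem := ![P, 1 - P]
  posSemidef a := by
    have hP : P.PosSemidef := by
      rw [← h1]
      nth_rewrite 1 [← h2]
      exact Matrix.posSemidef_conjTranspose_mul_self P
    have hQ : (1 - P).PosSemidef := by
      have : 1 - P = (1 - P)ᴴ * (1 - P) := by
        rw [Matrix.conjTranspose_sub, h2, Matrix.conjTranspose_one, mul_sub, mul_one, sub_mul,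
          one_mul, h1, sub_self, sub_zero]
      rw [this]
      exact Matrix.posSemidef_conjTranspose_mul_self _
    fin_cases a
    · exact hP
    · exact hQ
  sum_eq_one := by simp [Fin.sum_univ_two]

/-- A Bloch coordinate of the qubit block of an operator. -/
noncomputable def bloch {m : Type*} (e : Fin 2 → m) (x : Fin 3) (σ : Matrix m m ℂ) : ℝ :=
  (pauli x * σ.submatrix e e).trace.re

theorem bloch_eq_sum {m : Type*} (e : Fin 2 → m) (x : Fin 3) (σ : Matrix m m ℂ) :
    bloch e x σ = ∑ i, ∑ j, (pauli x i j * σ (e j) (e i)).re := by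
  simp only [bloch, Matrix.trace, Matrix.diag_apply, Matrix.mul_apply, Complex.re_sum,
    Matrix.submatrix_apply]

/-- For the qubit block, the squared trace minus the squared Bloch length is four times the
determinant, hence nonnegative. The trace of the block is at most one, and may be smaller in the
larger space. -/
theorem sum_bloch_sq_le_one {m : Type*} [Fintype m] {e : Fin 2 → m} (he : Function.Injective e)
    {τ : Matrix m m ℂ} (h : IsDensity τ) : ∑ x, bloch e x τ ^ 2 ≤ 1 := by
  classical
  have hd0 : ∀ k, 0 ≤ (τ k k).re := fun k => (Complex.nonneg_iff.mp h.1.diag_nonneg).1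
  have hdi : ∀ k, τ k k = ((τ k k).re : ℂ) := fun k =>
    Complex.ext rfl (Complex.nonneg_iff.mp (h.1.diag_nonneg (i := k))).2.symm
  have hsum : (τ (e 0) (e 0)).re + (τ (e 1) (e 1)).re ≤ 1 := by
    have ht : ∑ k, (τ k k).re = 1 := by
      have := congrArg Complex.re h.2
      simpa [Matrix.trace] using this
    have hne : e 0 ≠ e 1 := he.ne (by decide)
    rw [← ht, ← Finset.sum_pair (f := fun k => (τ k k).re) hne]
    exact Finset.sum_le_sum_of_subset_of_nonneg (Finset.subset_univ _) fun k _ _ => hd0 k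
  have hdet := (h.1.submatrix e).det_nonneg
  have h10 : τ (e 1) (e 0) = star (τ (e 0) (e 1)) := (h.1.isHermitian.apply _ _).symm
  rw [Matrix.det_fin_two] at hdet
  simp only [Matrix.submatrix_apply] at hdet
  rw [h10, hdi (e 0), hdi (e 1), Complex.star_def, Complex.mul_conj] at hdet
  have h2 : 0 ≤ (τ (e 0) (e 0)).re * (τ (e 1) (e 1)).re - Complex.normSq (τ (e 0) (e 1)) := by
    exact_mod_cast hdet
  rw [Complex.normSq_apply] at h2
  have hb0 : bloch e 0 τ = 2 * (τ (e 0) (e 1)).re := by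
    simp [bloch_eq_sum, pauli, h10]
    ring
  have hb1 : bloch e 1 τ = -2 * (τ (e 0) (e 1)).im := by
    simp [bloch_eq_sum, pauli, h10]
    ring
  have hb2 : bloch e 2 τ = (τ (e 0) (e 0)).re - (τ (e 1) (e 1)).re := by
    simp [bloch_eq_sum, pauli]
    ring
  rw [Fin.sum_univ_three, hb0, hb1, hb2]
  nlinarith [hd0 (e 0), hd0 (e 1)]

theorem sum_mul_bloch_sq_le {b : Fin 3 → ℝ} (hb : ∑ x, b x ^ 2 ≤ 1) {c : Fin 3 → ℝ}
    (hc : ∀ x, c x ^ 2 ≤ 1) : (∑ x, c x * b x) ≤ Real.sqrt 3 := by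
  apply Real.le_sqrt_of_sq_le
  calc (∑ x, c x * b x) ^ 2 ≤ (∑ x, c x ^ 2) * ∑ x, b x ^ 2 := Finset.sum_mul_sq_le_sq_mul_sq _ _ _
    _ ≤ (∑ _x : Fin 3, 1) * 1 :=
        mul_le_mul (Finset.sum_le_sum fun x _ => hc x) hb
          (Finset.sum_nonneg fun x _ => sq_nonneg _) (by positivity)
    _ = 3 := by simp

/-- The linear steering inequality for three Pauli measurements. -/
theorem HasLHSDecomposition.sum_bloch_le {m : Type} [Fintype m] {e : Fin 2 → m}
    (he : Function.Injective e) {σ : Fin 3 → Fin 2 → Matrix m m ℂ}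
    (h : HasLHSDecomposition (X := Fin 3) (k := fun _ => 2) σ) :
    ∑ x, (bloch e x (σ x 1) - bloch e x (σ x 0)) ≤ Real.sqrt 3 := by
  obtain ⟨Λ, mΛ, μ, p, τ, hμ, hpm, hp0, hp1, hτm, hτ, hσ⟩ := h
  have hp_le : ∀ x a l, p x a l ≤ 1 := by
    intro x a l
    rw [← hp1 x l]
    exact Finset.single_le_sum (f := fun a => p x a l) (fun a _ => hp0 x a l) (Finset.mem_univ a)
  have hI : ∀ x a i j, Integrable (fun l => (p x a l : ℂ) * τ l i j) μ := fun x a i j =>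
    integrable_mul_density (hpm x a) (hp0 x a) (hp_le x a) hτm hτ i j
  have hIre : ∀ x a i j, Integrable
      (fun l => (pauli x i j * ((p x a l : ℂ) * τ l (e j) (e i))).re) μ := fun x a i j =>
    ((hI x a (e j) (e i)).const_mul (pauli x i j)).re
  have hterm : ∀ x a l, p x a l * bloch e x (τ l)
      = ∑ i, ∑ j, (pauli x i j * ((p x a l : ℂ) * τ l (e j) (e i))).re := by
    intro x a l
    rw [bloch_eq_sum]
    simp only [Finset.mul_sum]
    refine Finset.sum_congr rfl fun i _ => Finset.sum_congr rfl fun j _ => ?_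
    rw [mul_left_comm, Complex.re_ofReal_mul]
  have hIb : ∀ x a, Integrable (fun l => p x a l * bloch e x (τ l)) μ := by
    intro x a
    simp_rw [hterm]
    exact integrable_finsetSum _ fun i _ => integrable_finsetSum _ fun j _ => hIre x a i j
  have hb : ∀ x a, bloch e x (σ x a) = ∫ l, p x a l * bloch e x (τ l) ∂μ := by
    intro x a
    simp_rw [hterm]
    rw [integral_finsetSum _ fun i _ => integrable_finsetSum _ fun j _ => hIre x a i j,
      bloch_eq_sum]
    refine Finset.sum_congr rfl fun i _ => ?_
    rw [integral_finsetSum _ fun j _ => hIre x a i j]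
    refine Finset.sum_congr rfl fun j _ => ?_
    rw [hσ, ← integral_const_mul]
    exact (integral_re ((hI x a (e j) (e i)).const_mul (pauli x i j))).symm
  have hdiff : ∀ x, bloch e x (σ x 1) - bloch e x (σ x 0)
      = ∫ l, (p x 1 l - p x 0 l) * bloch e x (τ l) ∂μ := by
    intro x
    rw [hb, hb, ← integral_sub (hIb x 1) (hIb x 0)]
    simp_rw [sub_mul]
  have hId : ∀ x, Integrable (fun l => (p x 1 l - p x 0 l) * bloch e x (τ l)) μ := by
    intro x
    simp_rw [sub_mul]
    exact (hIb x 1).sub (hIb x 0)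
  simp_rw [hdiff]
  rw [← integral_finsetSum _ fun x _ => hId x]
  -- For each hidden value the response differences lie in `[-1, 1]` and the Bloch vector in the
  -- unit ball, so Cauchy–Schwarz gives `√3` pointwise.
  calc ∫ l, ∑ x, (p x 1 l - p x 0 l) * bloch e x (τ l) ∂μ ≤ ∫ _l, Real.sqrt 3 ∂μ := by
        refine integral_mono (integrable_finsetSum _ fun x _ => hId x) (integrable_const _) fun l =>
          sum_mul_bloch_sq_le (sum_bloch_sq_le_one he (hτ l)) fun x => ?_
        have h1 := hp0 x 0 l
        have h2 := hp0 x 1 l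
        have h3 := hp_le x 0 l
        have h4 := hp_le x 1 l
        nlinarith
    _ = Real.sqrt 3 := by simp

/-- Pauli matrices are traceless, so only the term `-(v/2) N` survives. Its sign is the singlet's
anticorrelation, which is why the inequality takes outcome `1` minus outcome `0`. -/
theorem pauli_mul_werner_block (x : Fin 3) (v : ℝ) (N : Matrix (Fin 2) (Fin 2) ℂ) :
    (pauli x * ptraceA ((N ⊗ₖ (1 : Matrix (Fin 2) (Fin 2) ℂ)) * werner 2 v)).trace
      = -(v / 2) * (pauli x * N).trace := by
  have h : ptraceA ((N ⊗ₖ (1 : Matrix (Fin 2) (Fin 2) ℂ)) * werner 2 v)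
      = ((v : ℂ) / 2) • (N.trace • 1 - N) + ((1 - v) / 4 * N.trace : ℂ) • 1 := by
    ext i j
    rw [ptraceA_mul_werner]
    simp
    ring
  rw [h]
  simp [mul_add, mul_sub, trace_pauli]

/-- The two-qubit Werner state with visibility above `1 / √3`, embedded in a larger space, is
steerable with three measurements. -/
theorem steerableAB_embed_werner {m : Type} [Fintype m] [DecidableEq m] {e : Fin 2 → m}
    (he : Function.Injective e) {v : ℝ} (hv0 : 0 ≤ v) (hv : 1 < 3 * v ^ 2) :
    SteerableAB ((embed e ⊗ₖ embed e) * werner 2 v * (embed e ⊗ₖ embed e)ᴴ) := by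
  let Q : Fin 3 → Matrix m m ℂ := fun x => embed e * pauliProj x * (embed e)ᴴ
  have hQ1 : ∀ x, Q x * Q x = Q x := by
    intro x
    calc Q x * Q x = embed e * (pauliProj x * ((embed e)ᴴ * embed e) * pauliProj x) * (embed e)ᴴ := by
          simp only [Q, Matrix.mul_assoc]
      _ = Q x := by
          rw [embed_conjTranspose_mul_self he, Matrix.mul_one, pauliProj_mul_self]
  have hQ2 : ∀ x, (Q x)ᴴ = Q x := by
    intro x
    simp only [Q, Matrix.conjTranspose_mul, Matrix.conjTranspose_conjTranspose,
      conjTranspose_pauliProj, Matrix.mul_assoc]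
  have hQs : ∀ x, (Q x).submatrix e e = pauliProj x := fun x => embed_sandwich_submatrix he _
  have hQs' : ∀ x, (1 - Q x).submatrix e e = 1 - pauliProj x := by
    intro x
    rw [← hQs x]
    ext i j
    simp [Matrix.one_apply, he.eq_iff]
  refine ⟨Fin 3, fun _ => 2, fun x => projPOVM (Q x) (hQ1 x) (hQ2 x), fun hL => ?_⟩
  have hle := HasLHSDecomposition.sum_bloch_le he hL
  have hblock : ∀ (x : Fin 3) (N : Matrix m m ℂ), bloch e x (ptraceA ((N ⊗ₖ (1 : Matrix m m ℂ)) *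
      ((embed e ⊗ₖ embed e) * werner 2 v * (embed e ⊗ₖ embed e)ᴴ)))
      = (-(v / 2) * (pauli x * N.submatrix e e).trace : ℂ).re := by
    intro x N
    rw [← pauli_mul_werner_block, bloch]
    congr 3
    ext i j
    exact ptraceA_mul_embed_sandwich he N _ i j
  have hP : ∀ x, (pauli x * pauliProj x).trace = 1 := by
    intro x
    simp [pauliProj, mul_add, pauli_mul_self, trace_pauli]
  have hP' : ∀ x, (pauli x * (1 - pauliProj x)).trace = -1 := by
    intro x
    rw [mul_sub, Matrix.trace_sub, hP, mul_one, trace_pauli, zero_sub]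
  have h0 : ∀ x, bloch e x (assemblage ((embed e ⊗ₖ embed e) * werner 2 v * (embed e ⊗ₖ embed e)ᴴ)
      (k := fun _ : Fin 3 => 2) (fun x => projPOVM (Q x) (hQ1 x) (hQ2 x)) x 0) = -(v / 2) := by
    intro x
    refine (hblock x (Q x)).trans ?_
    rw [hQs, hP, mul_one]
    norm_cast
  have h1 : ∀ x, bloch e x (assemblage ((embed e ⊗ₖ embed e) * werner 2 v * (embed e ⊗ₖ embed e)ᴴ)
      (k := fun _ : Fin 3 => 2) (fun x => projPOVM (Q x) (hQ1 x) (hQ2 x)) x 1) = v / 2 := by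
    intro x
    refine (hblock x (1 - Q x)).trans ?_
    rw [hQs', hP', neg_mul_neg, mul_one]
    norm_cast
  simp_rw [h0, h1] at hle
  -- Each of the three settings contributes `v / 2 - (-(v / 2)) = v`.
  have h3 : 3 * v ≤ Real.sqrt 3 := by
    simp at hle
    linarith
  have h4 : (3 * v) ^ 2 ≤ 3 := by
    have := pow_le_pow_left₀ (by positivity) h3 2
    rwa [Real.sq_sqrt (by norm_num)] at this
  nlinarith

theorem steerableBA_embed_werner {m : Type} [Fintype m] [DecidableEq m] {e : Fin 2 → m}
    (he : Function.Injective e) {v : ℝ} (hv0 : 0 ≤ v) (hv : 1 < 3 * v ^ 2) :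
    SteerableBA ((embed e ⊗ₖ embed e) * werner 2 v * (embed e ⊗ₖ embed e)ᴴ) := by
  rw [SteerableBA, exchange_kronecker_sandwich, exchange_werner]
  exact steerableAB_embed_werner he hv0 hv

/-- Makes the genuine two-qubit state the case `e = id` of the embedded one. -/
theorem embed_id_sandwich (ω : Matrix (Fin 2 × Fin 2) (Fin 2 × Fin 2) ℂ) :
    (embed id ⊗ₖ embed id) * ω * (embed id ⊗ₖ embed id)ᴴ = ω := by
  have h : embed (id : Fin 2 → Fin 2) = 1 := Matrix.submatrix_id_id _
  rw [h, Matrix.one_kronecker_one]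
  simp

/-! ### Local filtering -/

theorem qubitIncl_eq_embed {d : ℕ} (hd : 2 ≤ d) :
    qubitIncl hd = embed fun k => (Sum.inl (Fin.castLE hd k) : Fin d ⊕ Unit) := by
  ext s k
  simp only [qubitIncl, embed, Matrix.sum_apply, Matrix.single_apply, Matrix.submatrix_apply,
    Matrix.one_apply, Fin.sum_univ_two, id]
  fin_cases k <;> simp [eq_comm]

theorem qubit_injective {d : ℕ} (hd : 2 ≤ d) :
    Function.Injective fun k => (Sum.inl (Fin.castLE hd k) : Fin d ⊕ Unit) :=
  Sum.inl_injective.comp (Fin.castLE_injective hd)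

theorem qubitFilter_eq {d : ℕ} (hd : 2 ≤ d) :
    qubitFilter hd = qubitIncl hd * (qubitIncl hd)ᴴ := by
  ext s t
  simp [qubitFilter, qubitIncl, Fin.sum_univ_two, Matrix.add_mul, Matrix.mul_add,
    Matrix.conjTranspose_single]

theorem conjTranspose_qubitFilter {d : ℕ} (hd : 2 ≤ d) :
    (qubitFilter hd)ᴴ = qubitFilter hd := by
  rw [qubitFilter_eq, Matrix.conjTranspose_mul, Matrix.conjTranspose_conjTranspose]

theorem qubitIncl_isometry {d : ℕ} (hd : 2 ≤ d) : (qubitIncl hd)ᴴ * qubitIncl hd = 1 := by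
  rw [qubitIncl_eq_embed]
  exact embed_conjTranspose_mul_self (qubit_injective hd)

theorem qubitFilter_mul_self {d : ℕ} (hd : 2 ≤ d) :
    qubitFilter hd * qubitFilter hd = qubitFilter hd := by
  rw [qubitFilter_eq, Matrix.mul_assoc, ← Matrix.mul_assoc _ (qubitIncl hd), qubitIncl_isometry,
    Matrix.one_mul]

/-- Compression removes the flag terms and turns `antiProj d` into `antiProj 2`. Up to the factor
`1/(d + 1)^2` the singlet has weight `2/d^2`, while the noise `𝟙/d^3` has weight `4/d^3` in units of
`𝟙/4`. The ratio `2/d` fixes the visibility, and the total weight is the success probability. -/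
theorem qubit_compression_rhoHS {d : ℕ} (hd : 2 ≤ d) :
    (qubitIncl hd ⊗ₖ qubitIncl hd)ᴴ * rhoHS d * (qubitIncl hd ⊗ₖ qubitIncl hd)
      = (1 / ((d : ℝ) + 1) ^ 2 * (2 / (d : ℝ) ^ 2) * (1 + 2 / (d : ℝ))) •
          werner 2 (1 / (1 + 2 / (d : ℝ))) := by
  have hd0 : (d : ℂ) ≠ 0 := by exact_mod_cast (by omega : d ≠ 0)
  have hd1 : (d : ℂ) - 1 ≠ 0 := by
    rw [sub_ne_zero]
    exact_mod_cast (by omega : d ≠ 1)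
  have hd2 : (d : ℂ) + 1 ≠ 0 := by exact_mod_cast d.succ_ne_zero
  have hd3 : (d : ℂ) + 2 ≠ 0 := by exact_mod_cast (by omega : d + 2 ≠ 0)
  let c : Fin 2 → Fin d := Fin.castLE hd
  have hc : Function.Injective c := Fin.castLE_injective hd
  have h : (qubitIncl hd ⊗ₖ qubitIncl hd)ᴴ * rhoHS d * (qubitIncl hd ⊗ₖ qubitIncl hd)
      = (rhoHS d).submatrix (Prod.map (fun k => Sum.inl (c k)) (fun k => Sum.inl (c k)))
          (Prod.map (fun k => Sum.inl (c k)) (fun k => Sum.inl (c k))) := by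
    rw [qubitIncl_eq_embed]
    ext ⟨i, j⟩ ⟨i', j'⟩
    simp [embed, Matrix.mul_apply, Fintype.sum_prod_type, Matrix.one_apply, c,
      apply_ite (starRingEnd ℂ)]
  rw [h]
  ext ⟨i, j⟩ ⟨i', j'⟩
  rw [Matrix.submatrix_apply]
  simp only [Prod.map_apply, rhoHS, flagB_inl_inl, flagA_inl_inl, Matrix.smul_apply, werner,
    antiProj, Matrix.add_apply, Matrix.sub_apply, swapOp, Matrix.of_apply, Matrix.one_apply,
    Prod.swap_prod_mk, Prod.mk.injEq, hc.eq_iff, Complex.real_smul, Fintype.card_fin]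
  generalize (if i = i' ∧ j = j' then (1 : ℂ) else 0) = δ
  generalize (if i = j' ∧ j = i' then (1 : ℂ) else 0) = s
  push_cast
  field_simp
  ring

theorem filterRaw_rhoHS {d : ℕ} (hd : 2 ≤ d) :
    filterRaw (qubitFilter hd) (qubitFilter hd) (rhoHS d)
      = (1 / ((d : ℝ) + 1) ^ 2 * (2 / (d : ℝ) ^ 2) * (1 + 2 / (d : ℝ))) •
        ((qubitIncl hd ⊗ₖ qubitIncl hd) * werner 2 (1 / (1 + 2 / (d : ℝ))) *
          (qubitIncl hd ⊗ₖ qubitIncl hd)ᴴ) := by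
  have hF : qubitFilter hd ⊗ₖ qubitFilter hd
      = (qubitIncl hd ⊗ₖ qubitIncl hd) * (qubitIncl hd ⊗ₖ qubitIncl hd)ᴴ := by
    rw [qubitFilter_eq, Matrix.conjTranspose_kronecker, Matrix.mul_kronecker_mul]
  rw [filterRaw, conjTranspose_qubitFilter, hF, ← Matrix.smul_mul, ← Matrix.mul_smul,
    ← qubit_compression_rhoHS hd]
  simp only [Matrix.mul_assoc]

theorem visibility_mem {d : ℕ} (hd : 2 ≤ d) :
    0 ≤ 1 / (1 + 2 / (d : ℝ)) ∧ 1 / (1 + 2 / (d : ℝ)) ≤ 1 := by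
  have : (0 : ℝ) ≤ 2 / d := by positivity
  refine ⟨by positivity, ?_⟩
  rw [div_le_one (by positivity)]
  linarith

theorem trace_filterRaw_rhoHS {d : ℕ} (hd : 2 ≤ d) :
    (filterRaw (qubitFilter hd) (qubitFilter hd) (rhoHS d)).trace
      = ((1 / ((d : ℝ) + 1) ^ 2 * (2 / (d : ℝ) ^ 2) * (1 + 2 / (d : ℝ)) : ℝ) : ℂ) := by
  have h := (isDensity_werner le_rfl (visibility_mem hd).1 (visibility_mem hd).2).2
  rw [filterRaw_rhoHS, Matrix.trace_smul, Matrix.trace_mul_cycle, Matrix.conjTranspose_kronecker,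
    ← Matrix.mul_kronecker_mul, qubitIncl_isometry, Matrix.one_kronecker_one, Matrix.one_mul, h]
  simp

theorem filter_probability_pos {d : ℕ} (hd : 2 ≤ d) :
    0 < 1 / ((d : ℝ) + 1) ^ 2 * (2 / (d : ℝ) ^ 2) * (1 + 2 / (d : ℝ)) := by
  have : (0 : ℝ) < d := by exact_mod_cast (by omega : 0 < d)
  positivity

theorem trace_filterRaw_rhoHS_ne_zero {d : ℕ} (hd : 2 ≤ d) :
    (filterRaw (qubitFilter hd) (qubitFilter hd) (rhoHS d)).trace ≠ 0 := by
  rw [trace_filterRaw_rhoHS hd]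
  exact_mod_cast (filter_probability_pos hd).ne'

theorem filtered_rhoHS {d : ℕ} (hd : 2 ≤ d) :
    filtered (qubitFilter hd) (qubitFilter hd) (rhoHS d)
      = (qubitIncl hd ⊗ₖ qubitIncl hd) * werner 2 (1 / (1 + 2 / (d : ℝ))) *
          (qubitIncl hd ⊗ₖ qubitIncl hd)ᴴ := by
  have hne := trace_filterRaw_rhoHS_ne_zero hd
  rw [filtered, trace_filterRaw_rhoHS hd] at *
  rw [filterRaw_rhoHS hd, ← Complex.coe_smul, smul_smul, inv_mul_cancel₀ hne, one_smul]

/-- The antisymmetric subspace of two qubits is the line spanned by the singlet. -/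
theorem singlet_eq_antiProj : singlet = antiProj 2 := by
  have h : (((√2)⁻¹ : ℝ) : ℂ) * (((√2)⁻¹ : ℝ) : ℂ) = 1 / 2 := by
    rw [← Complex.ofReal_mul, ← mul_inv, Real.mul_self_sqrt (by norm_num)]
    norm_num
  push_cast at h
  ext ⟨i, j⟩ ⟨k, l⟩
  fin_cases i <;> fin_cases j <;> fin_cases k <;> fin_cases l <;>
    simp [singlet, singletVec, antiProj, swapOp, Matrix.vecMulVec_apply, h]

theorem werner_two_eq {d : ℕ} (hd : 2 ≤ d) :
    werner 2 (1 / (1 + 2 / (d : ℝ))) =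
      (1 / (1 + 2 / (d : ℝ))) • (singlet + (2 / (d : ℝ)) • ((1 / 4 : ℝ) • 1)) := by
  have hd0 : (d : ℝ) ≠ 0 := by exact_mod_cast (by omega : d ≠ 0)
  have hd2 : (d : ℝ) + 2 ≠ 0 := by positivity
  rw [singlet_eq_antiProj, werner, smul_add, smul_smul, smul_smul]
  congr 2
  · push_cast
    ring
  · push_cast
    field_simp
    ring

/-- The measurement that tests whether the system lies in the qubit subspace. -/
noncomputable def qubitTest {d : ℕ} (hd : 2 ≤ d) : LocalMeasurement 2 (Fin d ⊕ Unit) where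
  kraus := ![qubitFilter hd, 1 - qubitFilter hd]
  complete := by
    simp [Fin.sum_univ_two, conjTranspose_qubitFilter, mul_sub, sub_mul, qubitFilter_mul_self]

end Steering

/-! ### The main theorem -/

theorem mainTheorem5 (d : ℕ) (hd : 2 ≤ d) :
    -- the doubly flagged Werner state is a quantum state, given by the following formula
    Steering.IsDensity (Steering.rhoHS d) ∧
    Steering.rhoHS d = (1 / ((d : ℝ) + 1) ^ 2) •
      ((Steering.incl (Fin d) ⊗ₖ Steering.incl (Fin d)) *
          Steering.werner d (((d : ℝ) - 1) / d) *
          (Steering.incl (Fin d) ⊗ₖ Steering.incl (Fin d))ᴴ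
        + (d : ℝ) •
          (Steering.flagProj (Fin d) ⊗ₖ
              ((1 / (d : ℝ)) • (Steering.incl (Fin d) * (Steering.incl (Fin d))ᴴ))
            + ((1 / (d : ℝ)) • (Steering.incl (Fin d) * (Steering.incl (Fin d))ᴴ)) ⊗ₖ
              Steering.flagProj (Fin d))
        + ((d : ℝ) ^ 2) • (Steering.flagProj (Fin d) ⊗ₖ Steering.flagProj (Fin d))) ∧
    -- it admits LHS models for POVMs in both directions
    Steering.UnsteerableAB (Steering.rhoHS d) ∧
    Steering.UnsteerableBA (Steering.rhoHS d) ∧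
    -- local filtering on both sides succeeds with non-zero probability and yields the two-qubit
    -- Werner state with visibility `1 / (1 + 2 / d)`
    (Steering.filterRaw (Steering.qubitFilter hd) (Steering.qubitFilter hd)
      (Steering.rhoHS d)).trace ≠ 0 ∧
    Steering.filtered (Steering.qubitFilter hd) (Steering.qubitFilter hd) (Steering.rhoHS d) =
      (Steering.qubitIncl hd ⊗ₖ Steering.qubitIncl hd) *
        Steering.werner 2 (1 / (1 + 2 / (d : ℝ))) *
        (Steering.qubitIncl hd ⊗ₖ Steering.qubitIncl hd)ᴴ ∧
    Steering.werner 2 (1 / (1 + 2 / (d : ℝ))) =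
      (1 / (1 + 2 / (d : ℝ))) •
        (Steering.singlet + (2 / (d : ℝ)) • ((1 / 4 : ℝ) • 1)) ∧
    -- for `d ≥ 3` this state is steerable in both directions, so there is hidden steering
    (3 ≤ d →
      Steering.SteerableAB (Steering.werner 2 (1 / (1 + 2 / (d : ℝ)))) ∧
      Steering.SteerableBA (Steering.werner 2 (1 / (1 + 2 / (d : ℝ)))) ∧
      Steering.SteerableAB (Steering.filtered (Steering.qubitFilter hd)
        (Steering.qubitFilter hd) (Steering.rhoHS d)) ∧
      Steering.SteerableBA (Steering.filtered (Steering.qubitFilter hd)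
        (Steering.qubitFilter hd) (Steering.rhoHS d)) ∧
      Steering.HasHiddenSteering (Steering.rhoHS d)) := by
  -- The visibility increases with `d`. At `d = 3` it is `3/5`, and `3 * (3/5)^2 = 27/25 > 1`; at `d
  -- = 2` it is `1/2`, below the threshold `1/√3`.
  have hv : 3 ≤ d → 1 < 3 * (1 / (1 + 2 / (d : ℝ))) ^ 2 := by
    intro h3
    have h3' : (3 : ℝ) ≤ d := by exact_mod_cast h3
    have h1 : 3 / 5 ≤ 1 / (1 + 2 / (d : ℝ)) := by
      have : 2 / (d : ℝ) ≤ 2 / 3 := by gcongr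
      rw [div_le_div_iff₀ (by norm_num) (by positivity)]
      linarith
    nlinarith
  have hv0 := (Steering.visibility_mem hd).1
  have hinj := Steering.qubit_injective hd
  refine ⟨Steering.isDensity_rhoHS hd, Steering.rhoHS_eq hd, Steering.unsteerableAB_rhoHS hd,
    Steering.unsteerableBA_rhoHS hd, Steering.trace_filterRaw_rhoHS_ne_zero hd,
    Steering.filtered_rhoHS hd, Steering.werner_two_eq hd, fun h3 => ?_⟩
  have hAB : Steering.SteerableAB (Steering.filtered (Steering.qubitFilter hd)
      (Steering.qubitFilter hd) (Steering.rhoHS d)) := by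
    rw [Steering.filtered_rhoHS hd, Steering.qubitIncl_eq_embed hd]
    exact Steering.steerableAB_embed_werner hinj hv0 (hv h3)
  have hBA : Steering.SteerableBA (Steering.filtered (Steering.qubitFilter hd)
      (Steering.qubitFilter hd) (Steering.rhoHS d)) := by
    rw [Steering.filtered_rhoHS hd, Steering.qubitIncl_eq_embed hd]
    exact Steering.steerableBA_embed_werner hinj hv0 (hv h3)
  refine ⟨?_, ?_, hAB, hBA, Steering.unsteerableAB_rhoHS hd, Steering.unsteerableBA_rhoHS hd,
    2, 2, Steering.qubitTest hd, Steering.qubitTest hd, 0, 0,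
    Steering.trace_filterRaw_rhoHS_ne_zero hd, Or.inl hAB⟩
  · rw [← Steering.embed_id_sandwich (Steering.werner 2 _)]
    exact Steering.steerableAB_embed_werner Function.injective_id hv0 (hv h3)
  · rw [← Steering.embed_id_sandwich (Steering.werner 2 _)]
    exact Steering.steerableBA_embed_werner Function.injective_id hv0 (hv h3)
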